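/- \textbf{Setting.} Let $\widehat B\subset\mathbb R^2$ be a bounded domain (the cross-section of a floating body in equilibrium) such that $B=\widehat B\cap\{y<0\}$ and $\widehat B\cap\{y>0\}$ are nonempty domains and $D=\widehat B\cap\{y=0\}=\{-a<x<a,\ y=0\}$, $a>0$. The water domain is $W=\{y<0\}\setminus\overline B$ (infinite depth) or $W=\{-h<y<0\}\setminus\overline B$ with $h>\sup_{(x,y)\in B}|y|$ (finite depth); it is assumed to be a Lipschitz domain, with unit normal $\vec n$ exterior to $W$. Let $F=\{y=0\}\setminus\overline D$ and $S=\partial\widehat B\cap\{y<0\}$ be the free surface and the wetted contour (both parts of $\partial W$). Let $g>0$, $\rho_0>0$, let $\rho\ge 0$ be the (integrable) density in $\widehat B$, with centre of mass $(x^{(0)},y^{(0)})$, and put $$I^M=\rho_0^{-1}\int_{\widehat B}\rho,\quad I^M_2=\rho_0^{-1}\int_{\widehat B}\rho\,[(x-x^{(0)})^2+(y-y^{(0)})^2],$$ $$I^D=\int_D dx,\quad I^D_x=\int_D(x-x^{(0)})\,dx,\quad I^D_{xx}=\int_D(x-x^{(0)})^2dx,\quad I^B_y=\int_B(y-y^{(0)})\,dx\,dy,$$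 $$E=\begin{pmatrix}I^M&0&0\\0&I^M&0\\0&0&I^M_2\end{pmatrix},\qquad K=\begin{pmatrix}0&0&0\\0&I^D&I^D_x\\0&I^D_x&I^D_{xx}+I^B_y\end{pmatrix}.$$ The equilibrium conditions are assumed: $I^M=\int_B dx\,dy$, $\int_B(x-x^{(0)})\,dx\,dy=0$, $K$ is positive semi-definite and its lower right $2\times2$ block is positive definite. Let $N=(n_1,n_2,(x-x^{(0)})n_2-(y-y^{(0)})n_1)^{T}$, $\omega>0$ and $\nu=\omega^2/g$. \textbf{Trapped modes.} Let $\mathcal X$ be either of the following two spaces of real functions on $W$ (they coincide when the depth is finite): the Sobolev space $H^1(W)$; or the space of functions that are locally in $H^1$ up to the boundary and have $\int_W|\nabla\varphi|^2<\infty$ and $\int_F|\varphi|^2dx<\infty$. Values on $F$ and $S$ are traces. The number $\omega$ is a trapping frequency (in $\mathcal X$) if there is a non-trivial pair $(\varphi,\chi)\in\mathcal X\times\mathbb R^3$ with $$\int_W\nabla\varphi\cdot\nabla\psi\,dx\,dy=\nu\int_F\varphi\psi\,dx+\omega\int_S\psi\,N^{T}\chi\,ds\quad\text{for all }\psi\in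 C_c^\infty(\mathbb R^2),$$ $$\omega^2E\chi=-\omega\int_S\varphi N\,ds+gK\chi .$$ \textbf{Proposition 2.} Suppose that $\omega^2$ is greater than or equal to the largest root $\lambda$ of $\det(\lambda E-gK)=0$, and that $$\nu\int_F|\varphi|^2\,dx<\int_W|\nabla\varphi|^2\,dx\,dy$$ for every non-trivial $\varphi\in\mathcal X$ that satisfies, weakly, $\nabla^2\varphi=0$ in $W$, $\partial_y\varphi=\nu\varphi$ on $F$ and, when the depth is finite, $\partial_y\varphi=0$ on the bottom (no condition is imposed on $S$). Then $\omega$ is not a trapping frequency in $\mathcal X$. This holds for both choices of $\mathcal X$, in infinite and in finite depth. -/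

import Mathlib

open MeasureTheory Set Filter Topology Matrix
open scoped InnerProductSpace

noncomputable section

namespace FreelyFloating

/-- The vertical plane, with coordinates `x = p 0` and `y = p 1` (the `y`-axis is directed
upwards, the mean free surface of the water lies on the `x`-axis). -/
abbrev Plane := EuclideanSpace ℝ (Fin 2)

/-- Arc length: the one-dimensional Hausdorff measure on the plane. -/
abbrev arcLength : Measure Plane := Measure.hausdorffMeasure 1

/-! ### Lipschitz domains and the exterior normal -/

/-- Near each of its boundary points the set lies, in suitable Cartesian coordinates, on one side
of the graph of a Lipschitz function. -/
def HasLipschitzBoundary (W : Set Plane) : Prop :=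
  ∀ p ∈ frontier W, ∃ (e : OrthonormalBasis (Fin 2) ℝ Plane) (f : ℝ → ℝ) (L : NNReal) (r : ℝ),
    LipschitzWith L f ∧ 0 < r ∧
      ∀ q ∈ Metric.ball p r, q ∈ W ↔ ⟪e 1, q⟫_ℝ < f ⟪e 0, q⟫_ℝ

/-- A domain (nonempty connected open set) with Lipschitz boundary. -/
structure IsLipschitzDomain (W : Set Plane) : Prop where
  isOpen : IsOpen W
  isConnected : IsConnected W
  lipschitz : HasLipschitzBoundary W

/-- `n` is the unit normal at `p` that points to the exterior of `W`: near `p`, and up to cones of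
arbitrarily small opening about the line orthogonal to `n`, the set `W` is the half-plane
`{q | ⟪q - p, n⟫ < 0}`. There is at most one such `n`. -/
def IsExteriorNormal (W : Set Plane) (p n : Plane) : Prop :=
  ‖n‖ = 1 ∧ ∀ ε > 0, ∃ δ > 0, ∀ q ∈ Metric.ball p δ,
    (⟪q - p, n⟫_ℝ < -ε * ‖q - p‖ → q ∈ W) ∧ (ε * ‖q - p‖ < ⟪q - p, n⟫_ℝ → q ∉ W)

open Classical in
/-- The exterior unit normal to `W` at `p` (zero where there is none). -/
def exteriorNormal (W : Set Plane) (p : Plane) : Plane :=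
  if h : ∃ n, IsExteriorNormal W p n then h.choose else 0

/-! ### Sobolev functions and their traces -/

/-- `G` is the weak gradient of `φ` in the open set `W`. -/
def HasWeakGradient (W : Set Plane) (φ : Plane → ℝ) (G : Plane → Plane) : Prop :=
  ∀ ψ : Plane → ℝ, ContDiff ℝ (⊤ : ℕ∞) ψ → HasCompactSupport ψ → tsupport ψ ⊆ W →
    ∫ p in W, φ p • gradient ψ p = -∫ p in W, ψ p • G p

/-- `φ` belongs to `H¹(W ∩ {|p| < R})` for every `R`, with the weak gradient `G`. -/
structure MemH1Loc (W : Set Plane) (φ : Plane → ℝ) (G : Plane → Plane) : Prop where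
  memLp : ∀ R : ℝ, MemLp φ 2 (volume.restrict (W ∩ Metric.ball 0 R))
  memLp_grad : ∀ R : ℝ, MemLp G 2 (volume.restrict (W ∩ Metric.ball 0 R))
  weak : HasWeakGradient W φ G

/-- `t` is the trace on `∂W` of the function `φ` with the weak gradient `G`: locally up to the
boundary, functions smooth in the closed domain converge simultaneously to `φ` in `H¹` and to `t`
in `L²` of the boundary. -/
structure HasTrace (W : Set Plane) (φ : Plane → ℝ) (G : Plane → Plane) (t : Plane → ℝ) :
    Prop where
  memLp : ∀ R : ℝ, MemLp t 2 (arcLength.restrict (frontier W ∩ Metric.ball 0 R))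
  approx : ∃ u : ℕ → Plane → ℝ, (∀ k, ContDiff ℝ (⊤ : ℕ∞) (u k)) ∧ ∀ R : ℝ,
    Tendsto (fun k => eLpNorm (fun p => u k p - φ p) 2
      (volume.restrict (W ∩ Metric.ball 0 R))) atTop (𝓝 0) ∧
    Tendsto (fun k => eLpNorm (fun p => gradient (u k) p - G p) 2
      (volume.restrict (W ∩ Metric.ball 0 R))) atTop (𝓝 0) ∧
    Tendsto (fun k => eLpNorm (fun p => u k p - t p) 2
      (arcLength.restrict (frontier W ∩ Metric.ball 0 R))) atTop (𝓝 0)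

/-! ### The water and the body -/

/-- The data of the problem: the domain occupied by the (cross-section of the) body in its
equilibrium position, the half-width `a` of its intersection with the free surface, the depth of
the water (`⊤` for infinite depth), the density distribution in the body, the constant density of
water, and the acceleration due to gravity. -/
structure FloatingSystem where
  body : Set Plane
  a : ℝ
  depth : WithTop ℝ
  density : Plane → ℝ
  waterDensity : ℝ
  gravity : ℝ

namespace FloatingSystem

variable (C : FloatingSystem)

/-- The immersed part `B` of the body. -/
def immersed : Set Plane := C.body ∩ {p | p 1 < 0}

/-- The water domain `W`: the half-plane `y < 0`, or the layer `-h < y < 0`, without the closure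
of the immersed part of the body. -/
def water : Set Plane :=
  {p | p 1 < 0 ∧ ((-(p 1) : ℝ) : WithTop ℝ) < C.depth} \ closure C.immersed

/-- The part `D` of the `x`-axis inside the body. -/
def waterPlane : Set Plane := C.body ∩ {p | p 1 = 0}

/-- The free surface at rest `F`. -/
def freeSurface : Set Plane := {p | p 1 = 0} \ closure C.waterPlane

/-- The wetted contour `S`. -/
def wetted : Set Plane := frontier C.body ∩ {p | p 1 < 0}

/-- The assumptions on the geometry of the body and of the water domain, on the density
distribution and on the physical constants. -/
structure IsAdmissible : Prop where
  body_open : IsOpen C.body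
  body_connected : IsConnected C.body
  body_bounded : Bornology.IsBounded C.body
  immersed_connected : IsConnected C.immersed
  above_connected : IsConnected (C.body \ closure {p | p 1 < 0})
  a_pos : 0 < C.a
  waterPlane_eq : C.waterPlane = {p | -C.a < p 0 ∧ p 0 < C.a ∧ p 1 = 0}
  draught_lt_depth : ((sSup ((fun p : Plane => |p 1|) '' C.immersed) : ℝ) : WithTop ℝ) < C.depth
  water_lipschitz : IsLipschitzDomain C.water
  freeSurface_subset : C.freeSurface ⊆ frontier C.water
  wetted_subset : C.wetted ⊆ frontier C.water
  density_nonneg : ∀ p ∈ C.body, 0 ≤ C.density p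
  density_integrable : IntegrableOn C.density C.body
  waterDensity_pos : 0 < C.waterDensity
  gravity_pos : 0 < C.gravity

/-- The abscissa of the centre of mass. -/
def x₀ : ℝ := (∫ p in C.body, C.density p * p 0) / ∫ p in C.body, C.density p

/-- The ordinate of the centre of mass. -/
def y₀ : ℝ := (∫ p in C.body, C.density p * p 1) / ∫ p in C.body, C.density p

/-- The mass of the body divided by the density of water. -/
def massIM : ℝ := C.waterDensity⁻¹ * ∫ p in C.body, C.density p

/-- The moment of inertia about the centre of mass divided by the density of water. -/
def inertiaIM : ℝ := C.waterDensity⁻¹ *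
  ∫ p in C.body, C.density p * ((p 0 - C.x₀) ^ 2 + (p 1 - C.y₀) ^ 2)

def momentD : ℝ := ∫ _x in Ioo (-C.a) C.a, (1 : ℝ)

def momentDx : ℝ := ∫ x in Ioo (-C.a) C.a, (x - C.x₀)

def momentDxx : ℝ := ∫ x in Ioo (-C.a) C.a, (x - C.x₀) ^ 2

def momentBy : ℝ := ∫ p in C.immersed, (p 1 - C.y₀)

/-- The mass/inertia matrix `E`. -/
def matE : Matrix (Fin 3) (Fin 3) ℝ :=
  !![C.massIM, 0, 0; 0, C.massIM, 0; 0, 0, C.inertiaIM]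

/-- The buoyancy matrix `K`. -/
def matK : Matrix (Fin 3) (Fin 3) ℝ :=
  !![0, 0, 0;
     0, C.momentD, C.momentDx;
     0, C.momentDx, C.momentDxx + C.momentBy]

/-- The lower right `2 × 2` block of `K`. -/
def matK' : Matrix (Fin 2) (Fin 2) ℝ :=
  !![C.momentD, C.momentDx; C.momentDx, C.momentDxx + C.momentBy]

/-- The subsidiary conditions on the equilibrium position: Archimedes' law, the centre of buoyancy
lies on the vertical line through the centre of mass, and the equilibrium is stable. -/
structure IsEquilibrium : Prop where
  archimedes : C.massIM = ∫ _p in C.immersed, (1 : ℝ)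
  buoyancy : ∫ p in C.immersed, (p 0 - C.x₀) = 0
  matK_posSemidef : C.matK.PosSemidef
  matK'_posDef : C.matK'.PosDef

/-- The vector `N = (n₁, n₂, (x - x₀, y - y₀) × n)`, where `n` is the unit normal exterior
to `W`. -/
def normalN (p : Plane) : Fin 3 → ℝ :=
  let n := exteriorNormal C.water p
  ![n 0, n 1, (p 0 - C.x₀) * n 1 - (p 1 - C.y₀) * n 0]

/-- The spectral parameter `ν = ω² / g`. -/
def nu (ω : ℝ) : ℝ := ω ^ 2 / C.gravity

/-! ### Function spaces on the water domain

A function is given together with its weak gradient `G` and its trace `t` on the boundary. -/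

/-- The space of functions that are locally in `H¹` up to the boundary and for which
`∫_W |∇φ|²` and `∫_F |φ|²` are finite; the sum of these two is the square of the norm. -/
structure MemEnergySpace (φ : Plane → ℝ) (G : Plane → Plane) (t : Plane → ℝ) : Prop where
  loc : MemH1Loc C.water φ G
  trace : HasTrace C.water φ G t
  grad_memLp : MemLp G 2 (volume.restrict C.water)
  trace_memLp : MemLp t 2 (arcLength.restrict C.freeSurface)

/-- The Sobolev space `H¹(W)`: both `φ` and its weak gradient are square integrable over `W`. (The
trace of such a function is always square integrable over the free surface.) -/
structure MemH1 (φ : Plane → ℝ) (G : Plane → Plane) (t : Plane → ℝ) : Prop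
    extends C.MemEnergySpace φ G t where
  memLp : MemLp φ 2 (volume.restrict C.water)

/-! ### Trapped modes -/

/-- The integral identity: Laplace's equation in `W`, the free surface condition on `F`, the
coupling condition `∂φ/∂n = ω Nᵀχ` on `S` and, when the depth is finite, the no flow condition on
the bottom. -/
def SolvesIntegralIdentity (ω : ℝ) (G : Plane → Plane) (t : Plane → ℝ) (χ : Fin 3 → ℝ) : Prop :=
  ∀ ψ : Plane → ℝ, ContDiff ℝ (⊤ : ℕ∞) ψ → HasCompactSupport ψ →
    ∫ p in C.water, ⟪G p, gradient ψ p⟫_ℝ =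
      C.nu ω * (∫ p in C.freeSurface, t p * ψ p ∂arcLength) +
        ω * ∫ p in C.wetted, ψ p * (C.normalN p ⬝ᵥ χ) ∂arcLength

/-- The equations of the body's motion `ω² E χ = - ω ∫_S φ N ds + g K χ`. -/
def SolvesBodyMotion (ω : ℝ) (t : Plane → ℝ) (χ : Fin 3 → ℝ) : Prop :=
  ω ^ 2 • (C.matE *ᵥ χ) =
    -(ω • fun j => ∫ p in C.wetted, t p * C.normalN p j ∂arcLength) + C.gravity • (C.matK *ᵥ χ)

/-- `ω` is a trapping frequency: there is a non-trivial real pair `(φ, χ)`, with `φ` in the function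
space `X`, that satisfies the integral identity and the equations of the body's motion. -/
def IsTrappingFrequency (X : (Plane → ℝ) → (Plane → Plane) → (Plane → ℝ) → Prop) (ω : ℝ) :
    Prop :=
  ∃ (φ : Plane → ℝ) (G : Plane → Plane) (t : Plane → ℝ) (χ : Fin 3 → ℝ),
    X φ G t ∧ ¬(φ =ᵐ[volume.restrict C.water] 0 ∧ χ = 0) ∧
      C.SolvesIntegralIdentity ω G t χ ∧ C.SolvesBodyMotion ω t χ

/-- Laplace's equation in `W`, the free surface condition on `F` and, when the depth is finite, the
no flow condition on the bottom, with no condition on `S`: the integral identity is required for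
the test functions that vanish near the wetted contour. -/
def SolvesWaterEquations (ω : ℝ) (G : Plane → Plane) (t : Plane → ℝ) : Prop :=
  ∀ ψ : Plane → ℝ, ContDiff ℝ (⊤ : ℕ∞) ψ → HasCompactSupport ψ →
    Disjoint (tsupport ψ) (closure C.wetted) →
      ∫ p in C.water, ⟪G p, gradient ψ p⟫_ℝ =
        C.nu ω * ∫ p in C.freeSurface, t p * ψ p ∂arcLength

/-- The inequality `ν ∫_F |φ|² < ∫_W |∇φ|²` holds for every non-trivial `φ` in the function space
`X` that satisfies Laplace's equation, the free surface condition and, when the depth is finite, the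
no flow condition on the bottom. -/
def StrictEnergyInequality (X : (Plane → ℝ) → (Plane → Plane) → (Plane → ℝ) → Prop) (ω : ℝ) :
    Prop :=
  ∀ (φ : Plane → ℝ) (G : Plane → Plane) (t : Plane → ℝ),
    X φ G t → ¬(φ =ᵐ[volume.restrict C.water] 0) → C.SolvesWaterEquations ω G t →
      C.nu ω * (∫ p in C.freeSurface, t p ^ 2 ∂arcLength) < ∫ p in C.water, ‖G p‖ ^ 2

end FloatingSystem

end FreelyFloating

end

/-! Testing the integral identity with `φ` itself gives the energy balance `∫_W |∇φ|² = ν ∫_F φ² + ω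
∫_S φ Nᵀχ` (`energy_identity`), and the scalar product of the equations of motion with `χ` turns the
last term into `g χᵀKχ - ω² χᵀEχ` (`work_eq`). Surge decouples in `ω²E - gK`, and on the two other
coordinates the form is nonnegative once `ω²` is not below the largest root of the pencil. So the
last term is at most `-ω² I^M χ₀² ≤ 0` (`surge_form_le_energy_form`), and `∫_W |∇φ|² ≤ ν ∫_F φ²`.
The strict inequality assumed for solutions of the water equations then forces `φ = 0`.

It remains to exclude a motion of the body in water at rest. If `φ = 0`, the form vanishes at `χ`,
hence `χ₀ = 0`, and the integral identity gives `Nᵀχ = 0` on `S`: the rigid velocity field `v` of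
the motion is tangent to `S`. As `v` is divergence-free, the flux of `v₂ v` leaves `B` through `D`
only, so that `∫_B v·∇v₂ = ∫_D v₂²` (`rigidField_flux`). Written out, this says that the quadratic
form of the lower block of `K` vanishes at `(χ₁, χ₂)`; the block is positive definite, so `χ = 0`
(`eq_zero_of_tangent`).

Two points need analysis. The function `φ` is neither smooth nor compactly supported, and membership
in the energy space does not include square integrability over `W`. It is replaced by smooth
approximants times a cutoff at distance `n`, and the error is controlled by a Hardy-type bound: the
`L²` norm of `φ` over an annulus of radius `n` is `O(n)` (`eLpNorm_waterAnnulus_le`), which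
compensates the factor `1/n` from the gradient of the cutoff. The other point is the divergence
theorem in `B`, whose boundary is known to be a Lipschitz graph only locally and only below the
`x`-axis: it is proved for Lipschitz graphs, localized by a partition of unity, and extended up to
`D` by a smooth step in `y`. -/

noncomputable section

namespace FreelyFloating

/-! ### Cartesian coordinates attached to an orthonormal basis -/

/-- The point with the coordinates `z` with respect to the orthonormal basis `e`. -/
def frame (e : OrthonormalBasis (Fin 2) ℝ Plane) (z : ℝ × ℝ) : Plane := z.1 • e 0 + z.2 • e 1

section Frame

variable (e : OrthonormalBasis (Fin 2) ℝ Plane)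

lemma inner_frame_zero (z : ℝ × ℝ) : ⟪e 0, frame e z⟫_ℝ = z.1 := by
  simp [frame, inner_add_right, inner_smul_right, e.inner_eq_ite]

lemma inner_frame_one (z : ℝ × ℝ) : ⟪e 1, frame e z⟫_ℝ = z.2 := by
  simp [frame, inner_add_right, inner_smul_right, e.inner_eq_ite]

lemma frame_inner (q : Plane) : frame e (⟪e 0, q⟫_ℝ, ⟪e 1, q⟫_ℝ) = q := by
  simpa [frame, Fin.sum_univ_two] using e.sum_repr' q

lemma frame_sub (z w : ℝ × ℝ) : frame e z - frame e w = frame e (z - w) := by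
  simp only [frame, Prod.fst_sub, Prod.snd_sub]; module

lemma inner_frame_frame (z w : ℝ × ℝ) : ⟪frame e z, frame e w⟫_ℝ = z.1 * w.1 + z.2 * w.2 := by
  have : frame e z = z.1 • e 0 + z.2 • e 1 := rfl
  rw [this, inner_add_left, inner_smul_left, inner_smul_left, inner_frame_zero, inner_frame_one]
  simp

lemma norm_frame_sq (z : ℝ × ℝ) : ‖frame e z‖ ^ 2 = z.1 ^ 2 + z.2 ^ 2 := by
  rw [← real_inner_self_eq_norm_sq, inner_frame_frame]; ring

lemma abs_fst_le_norm_frame (z : ℝ × ℝ) : |z.1| ≤ ‖frame e z‖ := by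
  apply abs_le_of_sq_le_sq _ (norm_nonneg _)
  rw [norm_frame_sq]; nlinarith [sq_nonneg z.2]

lemma abs_snd_le_norm_frame (z : ℝ × ℝ) : |z.2| ≤ ‖frame e z‖ := by
  apply abs_le_of_sq_le_sq _ (norm_nonneg _)
  rw [norm_frame_sq]; nlinarith [sq_nonneg z.1]

lemma norm_frame_le (z : ℝ × ℝ) : ‖frame e z‖ ≤ |z.1| + |z.2| := by
  refine (norm_add_le _ _).trans ?_
  simp [norm_smul]

lemma contDiff_frame {n : WithTop ℕ∞} : ContDiff ℝ n (frame e) := by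
  unfold frame; fun_prop

lemma continuous_frame : Continuous (frame e) := (contDiff_frame e (n := 0)).continuous

/-- The coordinates attached to an orthonormal basis, as a homeomorphism. -/
def frameHomeomorph : ℝ × ℝ ≃ₜ Plane where
  toFun := frame e
  invFun q := (⟪e 0, q⟫_ℝ, ⟪e 1, q⟫_ℝ)
  left_inv z := by simp [inner_frame_zero, inner_frame_one]
  right_inv q := frame_inner e q
  continuous_toFun := continuous_frame e
  continuous_invFun := by fun_prop

lemma frame_injective : Function.Injective (frame e) := (frameHomeomorph e).injective

lemma measurableEmbedding_frame : MeasurableEmbedding (frame e) :=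
  (frameHomeomorph e).measurableEmbedding

lemma measurePreserving_frame : MeasurePreserving (frame e) volume volume := by
  have h1 := (volume_preserving_finTwoArrow ℝ).symm
  have h2 := PiLp.volume_preserving_toLp (Fin 2)
  have h3 := e.measurePreserving_repr_symm
  have h := (h3.comp h2).comp h1
  convert h using 1
  ext1 z
  simp only [frame, Function.comp_apply]
  rw [← e.sum_repr_symm]
  simp [Fin.sum_univ_two, MeasurableEquiv.finTwoArrow]

lemma hasFDerivAt_frame (z : ℝ × ℝ) :
    HasFDerivAt (frame e) ((ContinuousLinearMap.fst ℝ ℝ ℝ).smulRight (e 0) +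
      (ContinuousLinearMap.snd ℝ ℝ ℝ).smulRight (e 1)) z :=
  (((ContinuousLinearMap.fst ℝ ℝ ℝ).smulRight (e 0) +
    (ContinuousLinearMap.snd ℝ ℝ ℝ).smulRight (e 1)).hasFDerivAt (x := z))

lemma fderiv_comp_frame {u : Plane → ℝ} (hu : Differentiable ℝ u) (z v : ℝ × ℝ) :
    fderiv ℝ (fun w => u (frame e w)) z v = ⟪gradient u (frame e z), frame e v⟫_ℝ := by
  have h := (hu (frame e z)).hasFDerivAt.comp z (hasFDerivAt_frame e z)
  have : HasFDerivAt (fun w => u (frame e w)) _ z := h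
  rw [this.fderiv, inner_gradient_left]
  rfl

end Frame

/-! ### The divergence theorem in the domain above a Lipschitz graph -/

/-- Integration by parts for Lipschitz functions, with the constant `1` as the other factor. This
stands in for the fundamental theorem of calculus on graphs that are merely Lipschitz. -/
lemma integral_deriv_eq_zero_of_lipschitz {g : ℝ → ℝ} {L : NNReal} (hg : LipschitzWith L g)
    (hs : HasCompactSupport g) : ∫ x, deriv g x = 0 := by
  -- A derivative along `v` of one factor becomes a derivative along `-v` of the other; `v = -1`
  -- leaves the derivative of `g` along `1`.
  have h := LipschitzWith.integral_lineDeriv_mul_eq (μ := (volume : Measure ℝ))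
    (LipschitzWith.const (1 : ℝ)) hg hs (-1)
  have hc : ∀ x, lineDeriv ℝ (fun _ : ℝ => (1 : ℝ)) x (-1) = 0 := fun x => by simp [lineDeriv]
  simp only [hc, zero_mul, integral_zero, neg_neg, mul_one] at h
  have : ∀ x, lineDeriv ℝ g x 1 = deriv g x := by
    intro x
    unfold lineDeriv
    have := deriv_comp_const_add g x 0
    simpa using this
  simp only [this] at h
  exact h.symm

/-- The vertical shear that maps the upper half-plane onto the domain above the graph of `f`. -/
def shear (f : ℝ → ℝ) (z : ℝ × ℝ) : ℝ × ℝ := (z.1, f z.1 + z.2)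

lemma measurePreserving_shear {f : ℝ → ℝ} (hf : Continuous f) :
    MeasurePreserving (shear f) volume volume := by
  have := MeasurePreserving.skew_product (MeasurePreserving.id (volume : Measure ℝ))
    (μc := (volume : Measure ℝ)) (μd := (volume : Measure ℝ)) (g := fun x y => f x + y)
    (by simp only [Function.uncurry_def]; fun_prop)
    (ae_of_all _ fun x => map_add_left_eq_self _ _)
  exact this

lemma measurableEmbedding_shear {f : ℝ → ℝ} (hf : Continuous f) :
    MeasurableEmbedding (shear f) :=
  (Homeomorph.mk (Equiv.mk (shear f) (fun z => (z.1, z.2 - f z.1)) (fun z => by simp [shear])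
    (fun z => by simp [shear])) (by change Continuous (shear f); unfold shear; fun_prop)
      (by change Continuous (fun z : ℝ × ℝ => (z.1, z.2 - f z.1)); fun_prop)).measurableEmbedding

section Graph

variable {f : ℝ → ℝ} {L : NNReal} {g : ℝ × ℝ → ℝ}

lemma setIntegral_above_graph (hf : Continuous f) (h : ℝ × ℝ → ℝ) :
    ∫ z in {z : ℝ × ℝ | f z.1 < z.2}, h z = ∫ z in univ ×ˢ Ioi (0 : ℝ), h (shear f z) := by
  rw [← (measurePreserving_shear hf).setIntegral_preimage_emb (measurableEmbedding_shear hf)]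
  congr 2
  ext z
  simp [shear]

lemma integrable_comp_shear (hf : Continuous f) {h : ℝ × ℝ → ℝ} (hh : Continuous h)
    (hs : HasCompactSupport h) : Integrable (fun z => h (shear f z)) :=
  (measurePreserving_shear hf).integrable_comp_of_integrable
    (hh.integrable_of_hasCompactSupport hs)

lemma continuous_fderiv_apply_const (hg : ContDiff ℝ 1 g) (v : ℝ × ℝ) :
    Continuous fun z => fderiv ℝ g z v :=
  (hg.continuous_fderiv one_ne_zero).clm_apply continuous_const

lemma integral_Ioi_fderiv_vertical (hg : ContDiff ℝ 1 g) (hs : HasCompactSupport g) (x c : ℝ) :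
    ∫ y in Ioi 0, fderiv ℝ g (x, c + y) (0, 1) = -g (x, c) := by
  have hd : ∀ y, HasDerivAt (fun y => g (x, c + y)) (fderiv ℝ g (x, c + y) (0, 1)) y := by
    intro y
    have h1 : HasDerivAt (fun y : ℝ => ((x, c + y) : ℝ × ℝ)) (0, 1) y :=
      (hasDerivAt_const y x).prodMk ((hasDerivAt_id y).const_add c)
    exact ((hg.differentiable one_ne_zero) (x, c + y)).hasFDerivAt.comp_hasDerivAt y h1
  have hcs : HasCompactSupport (fun y => g (x, c + y)) := by
    have : Topology.IsClosedEmbedding (fun y : ℝ => ((x, c + y) : ℝ × ℝ)) :=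
      have h : Function.LeftInverse (fun z : ℝ × ℝ => z.2 - c) (fun y : ℝ => (x, c + y)) :=
        fun y => by simp
      h.isClosedEmbedding (by fun_prop) (by fun_prop)
    exact hs.comp_isClosedEmbedding this
  have hc : ContDiff ℝ 1 (fun y => g (x, c + y)) := hg.comp (by fun_prop)
  have := hcs.integral_Ioi_deriv_eq hc 0
  simp only [add_zero] at this
  rw [← this]
  exact integral_congr_ae (ae_of_all _ fun y => (hd y).deriv.symm)

theorem integral_above_graph_vertical (hf : Continuous f) (hg : ContDiff ℝ 1 g)
    (hs : HasCompactSupport g) :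
    ∫ z in {z : ℝ × ℝ | f z.1 < z.2}, fderiv ℝ g z (0, 1) = -∫ x, g (x, f x) := by
  have hi := integrable_comp_shear hf (continuous_fderiv_apply_const hg (0, 1))
    (hs.fderiv_apply (𝕜 := ℝ) (0, 1))
  rw [setIntegral_above_graph hf, Measure.volume_eq_prod, setIntegral_prod _
    (by rw [← Measure.volume_eq_prod]; exact hi.integrableOn), setIntegral_univ, ← integral_neg]
  exact integral_congr_ae (ae_of_all _ fun x => integral_Ioi_fderiv_vertical hg hs x (f x))

/-- The function `x ↦ g (x, f x + y)` is Lipschitz with compact support, so its derivative has zero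
integral; the chain rule, valid at almost every `x`, splits this derivative into the two terms. -/
lemma integral_horizontal_comp_shear (hf : LipschitzWith L f) (hg : ContDiff ℝ 1 g)
    (hs : HasCompactSupport g) (y : ℝ) :
    ∫ x, fderiv ℝ g (x, f x + y) (1, 0) = -∫ x, deriv f x * fderiv ℝ g (x, f x + y) (0, 1) := by
  obtain ⟨M, hM⟩ := hg.lipschitzWith_of_hasCompactSupport hs one_ne_zero
  have hemb : Topology.IsClosedEmbedding (fun x : ℝ => ((x, f x + y) : ℝ × ℝ)) := by
    have hfc := hf.continuous
    refine Topology.IsClosedEmbedding.of_continuous_injective_isClosedMap (by fun_prop)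
      (fun a b h => (Prod.ext_iff.1 h).1) ?_
    have : Function.LeftInverse Prod.fst (fun x : ℝ => ((x, f x + y) : ℝ × ℝ)) := fun _ => rfl
    exact (this.isClosedEmbedding continuous_fst (by fun_prop)).isClosedMap
  have hlip : LipschitzWith (M * max 1 (L + 0)) (fun x => g (x, f x + y)) :=
    hM.comp (LipschitzWith.id.prodMk (hf.add (LipschitzWith.const y)))
  have h0 := integral_deriv_eq_zero_of_lipschitz hlip (hs.comp_isClosedEmbedding hemb)
  have hder : ∀ᵐ x, deriv (fun x => g (x, f x + y)) x =
      fderiv ℝ g (x, f x + y) (1, 0) + deriv f x * fderiv ℝ g (x, f x + y) (0, 1) := by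
    filter_upwards [hf.ae_differentiableAt (μ := volume)] with x hx
    have h1 : HasDerivAt (fun x : ℝ => ((x, f x + y) : ℝ × ℝ)) (1, deriv f x) x :=
      (hasDerivAt_id x).prodMk (hx.hasDerivAt.add_const y)
    have h2 := ((hg.differentiable one_ne_zero) (x, f x + y)).hasFDerivAt.comp_hasDerivAt x h1
    rw [show deriv (fun x => g (x, f x + y)) x = _ from h2.deriv]
    have : ((1, deriv f x) : ℝ × ℝ) = (1, 0) + deriv f x • (0, 1) := by simp
    rw [this, map_add, map_smul, smul_eq_mul]
  have hint : ∀ v, Integrable (fun x => fderiv ℝ g (x, f x + y) v) := fun v =>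
    ((continuous_fderiv_apply_const hg v).comp hemb.continuous).integrable_of_hasCompactSupport
      ((hs.fderiv_apply (𝕜 := ℝ) v).comp_isClosedEmbedding hemb)
  have hint2 : Integrable (fun x => deriv f x * fderiv ℝ g (x, f x + y) (0, 1)) :=
    (hint (0, 1)).bdd_mul (measurable_deriv f).aestronglyMeasurable
      (ae_of_all _ fun x => norm_deriv_le_of_lipschitz hf)
  rw [integral_congr_ae hder, integral_add (hint _) hint2] at h0
  linarith

/-- After the shear, integrating in `x` first trades the horizontal derivative for `-f'` times the
vertical one; integrating the latter in `y` leaves the boundary term. -/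
theorem integral_above_graph_horizontal (hf : LipschitzWith L f) (hg : ContDiff ℝ 1 g)
    (hs : HasCompactSupport g) :
    ∫ z in {z : ℝ × ℝ | f z.1 < z.2}, fderiv ℝ g z (1, 0) = ∫ x, deriv f x * g (x, f x) := by
  have hi : ∀ v, Integrable (fun z => fderiv ℝ g (shear f z) v) := fun v =>
    integrable_comp_shear hf.continuous (continuous_fderiv_apply_const hg v)
      (hs.fderiv_apply (𝕜 := ℝ) v)
  have hi2 : Integrable (fun z : ℝ × ℝ => deriv f z.1 * fderiv ℝ g (shear f z) (0, 1)) :=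
    (hi (0, 1)).bdd_mul ((measurable_deriv f).comp measurable_fst).aestronglyMeasurable
      (ae_of_all _ fun x => norm_deriv_le_of_lipschitz hf)
  rw [setIntegral_above_graph hf.continuous]
  have key : ∀ h : ℝ × ℝ → ℝ, ∫ z in univ ×ˢ Ioi (0 : ℝ), h z =
      ∫ z, h z ∂((volume : Measure ℝ).prod (volume.restrict (Ioi 0))) := by
    intro h
    rw [Measure.volume_eq_prod, ← Measure.prod_restrict, Measure.restrict_univ]
  have hr : ∀ {h : ℝ × ℝ → ℝ}, Integrable h →
      Integrable h ((volume : Measure ℝ).prod (volume.restrict (Ioi 0))) := by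
    intro h hh
    have := hh.integrableOn (s := univ ×ˢ Ioi (0 : ℝ))
    rwa [IntegrableOn, Measure.volume_eq_prod, ← Measure.prod_restrict,
      Measure.restrict_univ] at this
  rw [key, integral_prod_symm _ (hr (hi _))]
  have : ∀ y, ∫ x, fderiv ℝ g (shear f (x, y)) (1, 0) =
      ∫ x, -(deriv f x * fderiv ℝ g (shear f (x, y)) (0, 1)) := by
    intro y
    rw [integral_neg]
    exact integral_horizontal_comp_shear hf hg hs y
  simp_rw [this]
  rw [show (∫ y in Ioi 0, ∫ x, -(deriv f x * fderiv ℝ g (shear f (x, y)) (0, 1))) = _ from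
    (integral_prod_symm _ (hr hi2).neg).symm, integral_prod _ (hr hi2).neg]
  refine integral_congr_ae (ae_of_all _ fun x => ?_)
  simp only [shear, Pi.neg_apply]
  rw [integral_neg, integral_const_mul, integral_Ioi_fderiv_vertical hg hs x (f x)]
  ring

/-- If the divergence-free field `(α - κ y, β + κ x)` is tangent to the graph of a Lipschitz
function `f` wherever `θ` does not vanish on it, then the integral of the derivative of `θ` along
the field over the domain above the graph is zero. -/
theorem integral_above_graph_rigid_field (hf : LipschitzWith L f) (hg : ContDiff ℝ 1 g)
    (hs : HasCompactSupport g) (α β κ : ℝ)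
    (ht : ∀ᵐ x, g (x, f x) ≠ 0 → (α - κ * f x) * deriv f x = β + κ * x) :
    ∫ z in {z : ℝ × ℝ | f z.1 < z.2}, fderiv ℝ g z (α - κ * z.2, β + κ * z.1) = 0 := by
  set g₁ : ℝ × ℝ → ℝ := fun z => (α - κ * z.2) * g z with hg₁
  set g₂ : ℝ × ℝ → ℝ := fun z => (β + κ * z.1) * g z with hg₂
  have c₁ : ContDiff ℝ 1 g₁ := by fun_prop
  have c₂ : ContDiff ℝ 1 g₂ := by fun_prop
  have s₁ : HasCompactSupport g₁ := hs.mul_left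
  have s₂ : HasCompactSupport g₂ := hs.mul_left
  have i₁ := ((continuous_fderiv_apply_const c₁ (1, 0)).integrable_of_hasCompactSupport
    (s₁.fderiv_apply (𝕜 := ℝ) (1, 0)) (μ := volume)).integrableOn
    (s := {z : ℝ × ℝ | f z.1 < z.2})
  have i₂ := ((continuous_fderiv_apply_const c₂ (0, 1)).integrable_of_hasCompactSupport
    (s₂.fderiv_apply (𝕜 := ℝ) (0, 1)) (μ := volume)).integrableOn
    (s := {z : ℝ × ℝ | f z.1 < z.2})
  -- The coefficient `α - κ y` does not depend on `x`, nor `β + κ x` on `y`, so both can be moved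
  -- under the derivatives: the field is divergence-free.
  have hpt : ∀ z : ℝ × ℝ, fderiv ℝ g z (α - κ * z.2, β + κ * z.1) =
      fderiv ℝ g₁ z (1, 0) + fderiv ℝ g₂ z (0, 1) := by
    intro z
    have hgz := ((hg.differentiable one_ne_zero) z).hasFDerivAt
    have a₁ : HasFDerivAt (fun z : ℝ × ℝ => α - κ * z.2)
        (-(κ • ContinuousLinearMap.snd ℝ ℝ ℝ)) z := (hasFDerivAt_snd.const_mul κ).const_sub α
    have a₂ : HasFDerivAt (fun z : ℝ × ℝ => β + κ * z.1)
        (κ • ContinuousLinearMap.fst ℝ ℝ ℝ) z := (hasFDerivAt_fst.const_mul κ).const_add β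
    have e₁ : fderiv ℝ g₁ z = _ := (a₁.mul hgz).fderiv
    have e₂ : fderiv ℝ g₂ z = _ := (a₂.mul hgz).fderiv
    have : ((α - κ * z.2, β + κ * z.1) : ℝ × ℝ) =
      (α - κ * z.2) • (1, 0) + (β + κ * z.1) • (0, 1) := by simp
    rw [e₁, e₂, this, map_add, map_smul, map_smul]
    simp
  simp_rw [hpt]
  rw [integral_add i₁ i₂, integral_above_graph_horizontal hf c₁ s₁,
    integral_above_graph_vertical hf.continuous c₂ s₂, ← sub_eq_add_neg, sub_eq_zero]
  refine integral_congr_ae ?_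
  filter_upwards [ht] with x hx
  by_cases h0 : g (x, f x) = 0
  · simp [hg₁, hg₂, h0]
  · simp only [hg₁, hg₂]
    linear_combination g (x, f x) * hx h0

end Graph

/-! ### Lipschitz boundaries: the normal and the arc length -/

/-- A short step from `p` along `m - n` makes an acute angle with `m` and an obtuse one with `n`, so
two different normals would put the same point outside and inside `W`. -/
lemma IsExteriorNormal.unique {W : Set Plane} {p m n : Plane} (hm : IsExteriorNormal W p m)
    (hn : IsExteriorNormal W p n) : m = n := by
  by_contra hne
  set c := ⟪m, n⟫_ℝ with hc
  have hc1 : c < 1 := by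
    have := (inner_lt_one_iff_real_of_norm_eq_one hm.1 hn.1).2 hne
    exact this
  set v := m - n with hv
  have hvm : ⟪v, m⟫_ℝ = 1 - c := by
    rw [hv, inner_sub_left, real_inner_self_eq_norm_sq, hm.1, real_inner_comm, ← hc]; norm_num
  have hvn : ⟪v, n⟫_ℝ = c - 1 := by
    rw [hv, inner_sub_left, real_inner_self_eq_norm_sq, hn.1, ← hc]; norm_num
  have hv0 : 0 < ‖v‖ := norm_pos_iff.2 (sub_ne_zero.2 hne)
  -- Half the cosine of the angle between `v` and `m`, so that the step lies strictly inside both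
  -- cones.
  set ε := (1 - c) / (2 * ‖v‖) with hε
  have hε0 : 0 < ε := div_pos (by linarith) (by positivity)
  have hεv : ε * ‖v‖ < 1 - c := by
    rw [hε, div_mul_eq_mul_div, div_lt_iff₀ (by positivity)]; nlinarith
  obtain ⟨δ₁, hδ₁, H₁⟩ := hm.2 ε hε0
  obtain ⟨δ₂, hδ₂, H₂⟩ := hn.2 ε hε0
  set s := min δ₁ δ₂ / (2 * ‖v‖) with hs
  have hs0 : 0 < s := by positivity
  have hsv : s * ‖v‖ < min δ₁ δ₂ := by
    rw [hs, div_mul_eq_mul_div, div_lt_iff₀ (by positivity)]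
    nlinarith [lt_min hδ₁ hδ₂]
  have hq : p + s • v - p = s • v := by abel
  have hnorm : ‖s • v‖ = s * ‖v‖ := by rw [norm_smul, Real.norm_of_nonneg hs0.le]
  have hd : dist (p + s • v) p = s * ‖v‖ := by rw [dist_eq_norm, hq, hnorm]
  have h₁ := (H₁ (p + s • v) (by rw [Metric.mem_ball, hd]; exact hsv.trans_le (min_le_left _ _))).2
  have h₂ := (H₂ (p + s • v) (by rw [Metric.mem_ball, hd]; exact hsv.trans_le (min_le_right _ _))).1
  rw [hq, hnorm, inner_smul_left, hvm] at h₁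
  rw [hq, hnorm, inner_smul_left, hvn] at h₂
  simp only [conj_trivial] at h₁ h₂
  exact h₁ (by nlinarith) (h₂ (by nlinarith))

lemma exteriorNormal_eq {W : Set Plane} {p n : Plane} (h : IsExteriorNormal W p n) :
    exteriorNormal W p = n := by
  have hex : ∃ n, IsExteriorNormal W p n := ⟨n, h⟩
  rw [exteriorNormal, dif_pos hex]
  exact hex.choose_spec.unique h

lemma norm_exteriorNormal_le (W : Set Plane) (p : Plane) : ‖exteriorNormal W p‖ ≤ 1 := by
  unfold exteriorNormal
  split_ifs with h
  · exact h.choose_spec.1.le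
  · simp

/-- In the ball of radius `r` about `p` the set `W` is the domain below the graph of `f`. -/
structure IsLocalSubgraph (W : Set Plane) (p : Plane) (e : OrthonormalBasis (Fin 2) ℝ Plane)
    (f : ℝ → ℝ) (L : NNReal) (r : ℝ) : Prop where
  lipschitz : LipschitzWith L f
  pos : 0 < r
  mem_iff : ∀ q ∈ Metric.ball p r, q ∈ W ↔ ⟪e 1, q⟫_ℝ < f ⟪e 0, q⟫_ℝ

/-- The parametrization of the graph of `f`. -/
def graphMap (e : OrthonormalBasis (Fin 2) ℝ Plane) (f : ℝ → ℝ) (x : ℝ) : Plane :=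
  frame e (x, f x)

/-- The unit normal, directed upwards, to the graph of `f`. -/
def graphNormal (e : OrthonormalBasis (Fin 2) ℝ Plane) (f : ℝ → ℝ) (x : ℝ) : Plane :=
  (√(1 + deriv f x ^ 2))⁻¹ • frame e (-deriv f x, 1)

namespace IsLocalSubgraph

variable {W : Set Plane} {p : Plane} {e : OrthonormalBasis (Fin 2) ℝ Plane} {f : ℝ → ℝ}
  {L : NNReal} {r : ℝ}

lemma graphMap_mem_closure (h : IsLocalSubgraph W p e f L r) {x : ℝ}
    (hx : graphMap e f x ∈ Metric.ball p r) : graphMap e f x ∈ closure W := by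
  have hlim : Tendsto (fun t : ℝ => frame e (x, f x - t)) (𝓝[>] 0) (𝓝 (graphMap e f x)) := by
    have : Continuous (fun t : ℝ => frame e (x, f x - t)) :=
      (continuous_frame e).comp (by fun_prop)
    have := (this.tendsto 0).mono_left (nhdsWithin_le_nhds (s := Ioi 0))
    simpa [graphMap] using this
  refine mem_closure_of_tendsto hlim ?_
  filter_upwards [hlim (Metric.isOpen_ball.mem_nhds hx), self_mem_nhdsWithin] with t ht ht0
  rw [h.mem_iff _ ht, inner_frame_one, inner_frame_zero]
  exact sub_lt_self _ ht0

lemma mem_frontier_iff (h : IsLocalSubgraph W p e f L r) {q : Plane}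
    (hq : q ∈ Metric.ball p r) : q ∈ frontier W ↔ ⟪e 1, q⟫_ℝ = f ⟪e 0, q⟫_ℝ := by
  have hfc := h.lipschitz.continuous
  constructor
  · intro hqW
    set A : Set Plane := {q | ⟪e 1, q⟫_ℝ < f ⟪e 0, q⟫_ℝ} with hA
    have hAW : W ∩ Metric.ball p r = A ∩ Metric.ball p r := by
      ext q
      exact ⟨fun hq => ⟨(h.mem_iff q hq.2).1 hq.1, hq.2⟩,
        fun hq => ⟨(h.mem_iff q hq.2).2 hq.1, hq.2⟩⟩
    have h1 : q ∈ frontier W ∩ Metric.ball p r := ⟨hqW, hq⟩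
    rw [← frontier_inter_open_inter Metric.isOpen_ball, hAW,
      frontier_inter_open_inter Metric.isOpen_ball] at h1
    exact frontier_lt_subset_eq (by fun_prop) (by fun_prop) h1.1
  · intro hqf
    have hqg : graphMap e f ⟪e 0, q⟫_ℝ = q := by rw [graphMap, ← hqf, frame_inner]
    refine ⟨?_, fun hint => ?_⟩
    · have := h.graphMap_mem_closure (x := ⟪e 0, q⟫_ℝ) (by rwa [hqg])
      rwa [hqg] at this
    · have := (h.mem_iff q hq).1 (interior_subset hint)
      exact this.ne hqf

lemma graphMap_inner_of_mem_frontier (h : IsLocalSubgraph W p e f L r) {q : Plane}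
    (hq : q ∈ Metric.ball p r) (hqW : q ∈ frontier W) : graphMap e f ⟪e 0, q⟫_ℝ = q := by
  rw [graphMap, ← (h.mem_frontier_iff hq).1 hqW, frame_inner]

lemma graphMap_mem_frontier (h : IsLocalSubgraph W p e f L r) {x : ℝ}
    (hx : graphMap e f x ∈ Metric.ball p r) : graphMap e f x ∈ frontier W := by
  rw [h.mem_frontier_iff hx, graphMap, inner_frame_one, inner_frame_zero]

/-- Differentiability of `f` at `x` means that near this point the graph stays within an arbitrarily
thin cone about its tangent. -/
lemma isExteriorNormal_graphMap (h : IsLocalSubgraph W p e f L r) {x : ℝ}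
    (hx : graphMap e f x ∈ Metric.ball p r) (hd : DifferentiableAt ℝ f x) :
    IsExteriorNormal W (graphMap e f x) (graphNormal e f x) := by
  set s := √(1 + deriv f x ^ 2) with hs
  have hs1 : 1 ≤ s := by rw [hs]; exact Real.one_le_sqrt.2 (by nlinarith [sq_nonneg (deriv f x)])
  have hs0 : 0 < s := by linarith
  have hss : s ^ 2 = 1 + deriv f x ^ 2 := Real.sq_sqrt (by positivity)
  refine ⟨?_, fun ε hε => ?_⟩
  · have : ‖graphNormal e f x‖ ^ 2 = 1 := by
      rw [graphNormal, norm_smul, mul_pow, norm_frame_sq, ← hs, norm_inv,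
        Real.norm_of_nonneg hs0.le, inv_pow, hss]
      have : 1 + deriv f x ^ 2 ≠ 0 := by positivity
      field_simp; ring
    nlinarith [norm_nonneg (graphNormal e f x)]
  · have ho := (hasDerivAt_iff_isLittleO.1 hd.hasDerivAt).def hε
    obtain ⟨δ, hδ, H⟩ := Metric.eventually_nhds_iff.1 ho
    obtain ⟨ρ, hρ, Hρ⟩ := Metric.isOpen_iff.1 Metric.isOpen_ball _ hx
    refine ⟨min δ ρ, lt_min hδ hρ, fun q hq => ?_⟩
    have hqb : q ∈ Metric.ball p r :=
      Hρ (Metric.ball_subset_ball (min_le_right _ _) hq)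
    obtain ⟨z, rfl⟩ := (frameHomeomorph e).surjective q
    change frame e z ∈ _ at hq
    change frame e z ∈ _ at hqb
    change (_ → frame e z ∈ W) ∧ (_ → frame e z ∉ W)
    change (⟪frame e z - graphMap e f x, graphNormal e f x⟫_ℝ <
      -ε * ‖frame e z - graphMap e f x‖ → frame e z ∈ W) ∧
      (ε * ‖frame e z - graphMap e f x‖ < ⟪frame e z - graphMap e f x, graphNormal e f x⟫_ℝ →
        frame e z ∉ W)
    rw [h.mem_iff _ hqb, inner_frame_one, inner_frame_zero]
    have hn : frame e z - graphMap e f x = frame e (z - (x, f x)) := frame_sub e _ _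
    have h1 := abs_fst_le_norm_frame e (z - (x, f x))
    rw [Metric.mem_ball, dist_eq_norm, hn] at hq
    have hz := H (y := z.1) (by
      rw [Real.dist_eq]
      exact lt_of_le_of_lt h1 (hq.trans_le (min_le_left _ _)))
    rw [hn, graphNormal, inner_smul_right, inner_frame_frame, ← hs]
    simp only [Prod.fst_sub, Prod.snd_sub, smul_eq_mul, Real.norm_eq_abs] at hz h1 ⊢
    set ℓ := ‖frame e (z - (x, f x))‖
    have hz2 : |f z.1 - f x - (z.1 - x) * deriv f x| ≤ ε * ℓ :=
      hz.trans (mul_le_mul_of_nonneg_left h1 hε.le)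
    have hℓ : 0 ≤ ε * ℓ := by positivity
    rw [abs_le] at hz2
    rw [inv_mul_lt_iff₀ hs0, lt_inv_mul_iff₀ hs0, not_lt]
    constructor <;> intro hh <;> nlinarith

lemma exteriorNormal_graphMap (h : IsLocalSubgraph W p e f L r) {x : ℝ}
    (hx : graphMap e f x ∈ Metric.ball p r) (hd : DifferentiableAt ℝ f x) :
    exteriorNormal W (graphMap e f x) = graphNormal e f x :=
  exteriorNormal_eq (h.isExteriorNormal_graphMap hx hd)

lemma lipschitzWith_graphMap (h : IsLocalSubgraph W p e f L r) :
    LipschitzWith (1 + L) (graphMap e f) := by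
  refine LipschitzWith.of_dist_le_mul fun x y => ?_
  rw [dist_eq_norm, graphMap, graphMap, frame_sub]
  refine (norm_frame_le _ _).trans ?_
  have := h.lipschitz.dist_le_mul x y
  simp only [Real.dist_eq, Prod.fst_sub, Prod.snd_sub, NNReal.coe_add, NNReal.coe_one] at this ⊢
  linarith

/-- A Lipschitz map does not create length. This serves to discard the parameters at which `f` is
not differentiable. -/
lemma arcLength_graphMap_image_eq_zero (h : IsLocalSubgraph W p e f L r) {Z : Set ℝ}
    (hZ : volume Z = 0) : arcLength (graphMap e f '' Z) = 0 := by
  have := h.lipschitzWith_graphMap.hausdorffMeasure_image_le zero_le_one Z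
  rw [hausdorffMeasure_real, hZ, mul_zero] at this
  exact le_antisymm this zero_le

lemma arcLength_frontier_inter_ball_lt_top (h : IsLocalSubgraph W p e f L r) :
    arcLength (frontier W ∩ Metric.ball p r) < ⊤ := by
  have hsub : frontier W ∩ Metric.ball p r ⊆
      graphMap e f '' Metric.ball ⟪e 0, p⟫_ℝ r := by
    rintro q ⟨hqW, hq⟩
    refine ⟨⟪e 0, q⟫_ℝ, ?_, h.graphMap_inner_of_mem_frontier hq hqW⟩
    rw [Metric.mem_ball, dist_eq_norm, ← inner_sub_right]
    rw [Metric.mem_ball, dist_eq_norm] at hq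
    exact (norm_inner_le_norm _ _).trans_lt (by simpa using hq)
  refine (measure_mono hsub).trans_lt ?_
  refine (h.lipschitzWith_graphMap.hausdorffMeasure_image_le zero_le_one _).trans_lt ?_
  rw [hausdorffMeasure_real]
  exact ENNReal.mul_lt_top (by simp) measure_ball_lt_top

/-- By Rademacher's theorem the normal, which is defined by choice, coincides off a set of zero
length with a measurable function of the graph parameter. -/
lemma aemeasurable_exteriorNormal (h : IsLocalSubgraph W p e f L r) :
    AEMeasurable (exteriorNormal W) (arcLength.restrict (frontier W ∩ Metric.ball p r)) := by
  have hm : Measurable (fun q : Plane => graphNormal e f ⟪e 0, q⟫_ℝ) := by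
    have h1 : Measurable (graphNormal e f) := by
      have := measurable_deriv f
      have := (continuous_frame e).measurable
      unfold graphNormal
      fun_prop
    exact h1.comp (by fun_prop)
  refine ⟨_, hm, ?_⟩
  have hZ := h.arcLength_graphMap_image_eq_zero (ae_iff.1 (h.lipschitz.ae_differentiableAt))
  rw [Filter.EventuallyEq, ae_restrict_iff'
    (isClosed_frontier.measurableSet.inter Metric.isOpen_ball.measurableSet)]
  filter_upwards [measure_eq_zero_iff_ae_notMem.1 hZ] with q hq hqW
  have hg := h.graphMap_inner_of_mem_frontier hqW.2 hqW.1
  have hd : DifferentiableAt ℝ f ⟪e 0, q⟫_ℝ := by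
    by_contra hd
    exact hq ⟨_, hd, hg⟩
  have := h.exteriorNormal_graphMap (by rw [hg]; exact hqW.2) hd
  rwa [hg] at this

/-- Projection to the first coordinate is 1-Lipschitz, so a set of zero length has a null set of
parameters: properties pass from arc length to the parameter. -/
lemma eventually_graphMap_mem {S : Set Plane} {P : Plane → Prop}
    (h : IsLocalSubgraph W p e f L r) (hP : ∀ᵐ q ∂arcLength.restrict S, P q)
    (hS : ∀ q ∈ Metric.ball p r, q ∈ frontier W → q ∈ S) :
    ∀ᵐ x, graphMap e f x ∈ Metric.ball p r → P (graphMap e f x) := by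
  have hP' : arcLength ({q | ¬ P q} ∩ S) = 0 := by
    have h1 := ae_iff.1 hP
    exact le_antisymm ((Measure.le_restrict_apply _ _).trans h1.le) zero_le
  rw [ae_iff]
  have hlip : LipschitzWith 1 (fun q : Plane => ⟪e 0, q⟫_ℝ) := by
    refine LipschitzWith.of_dist_le_mul fun x y => ?_
    rw [dist_eq_norm, ← inner_sub_right, dist_eq_norm]
    simpa using norm_inner_le_norm (𝕜 := ℝ) (e 0) (x - y)
  have h2 := hlip.hausdorffMeasure_image_le zero_le_one ({q | ¬ P q} ∩ S)
  rw [hausdorffMeasure_real, hP', mul_zero] at h2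
  refine le_antisymm ((measure_mono ?_).trans h2) zero_le
  intro x hx
  simp only [Classical.not_imp, mem_ofPred_eq] at hx
  exact ⟨graphMap e f x, ⟨hx.2, hS _ hx.1 (h.graphMap_mem_frontier hx.1)⟩, inner_frame_zero e _⟩

end IsLocalSubgraph

/-! ### Bounded pieces of the boundary, by compactness -/

lemma HasLipschitzBoundary.exists_isLocalSubgraph {W : Set Plane} (hW : HasLipschitzBoundary W)
    {p : Plane} (hp : p ∈ frontier W) :
    ∃ (e : OrthonormalBasis (Fin 2) ℝ Plane) (f : ℝ → ℝ) (L : NNReal) (r : ℝ),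
      IsLocalSubgraph W p e f L r := by
  obtain ⟨e, f, L, r, h1, h2, h3⟩ := hW p hp
  exact ⟨e, f, L, r, h1, h2, h3⟩

lemma HasLipschitzBoundary.exists_finite_cover {W : Set Plane} (hW : HasLipschitzBoundary W)
    (R : ℝ) : ∃ (t : Finset Plane) (ρ : Plane → ℝ),
      (∀ p ∈ t, arcLength (frontier W ∩ Metric.ball p (ρ p)) < ⊤ ∧
        AEMeasurable (exteriorNormal W) (arcLength.restrict (frontier W ∩ Metric.ball p (ρ p)))) ∧
      frontier W ∩ Metric.ball 0 R ⊆ ⋃ p ∈ t, frontier W ∩ Metric.ball p (ρ p) := by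
  have hK : IsCompact (frontier W ∩ Metric.closedBall 0 R) :=
    (isCompact_closedBall 0 R).inter_left isClosed_frontier
  have : ∀ p : Plane, ∃ ρ : ℝ, p ∈ frontier W → 0 < ρ ∧
      arcLength (frontier W ∩ Metric.ball p ρ) < ⊤ ∧
        AEMeasurable (exteriorNormal W) (arcLength.restrict (frontier W ∩ Metric.ball p ρ)) := by
    intro p
    by_cases hp : p ∈ frontier W
    · obtain ⟨e, f, L, r, h⟩ := hW.exists_isLocalSubgraph hp
      exact ⟨r, fun _ => ⟨h.pos, h.arcLength_frontier_inter_ball_lt_top,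
        h.aemeasurable_exteriorNormal⟩⟩
    · exact ⟨0, fun h => absurd h hp⟩
  choose ρ hρ using this
  obtain ⟨t, ht, htc⟩ := hK.elim_nhds_subcover (fun p => Metric.ball p (ρ p))
    (fun p hp => Metric.ball_mem_nhds p (hρ p hp.1).1)
  refine ⟨t, ρ, fun p hp => (hρ p (ht p hp).1).2, fun q hq => ?_⟩
  obtain ⟨p, hp, hqp⟩ := mem_iUnion₂.1 (htc ⟨hq.1, Metric.ball_subset_closedBall hq.2⟩)
  exact mem_iUnion₂.2 ⟨p, hp, hq.1, hqp⟩

lemma HasLipschitzBoundary.arcLength_frontier_lt_top {W : Set Plane}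
    (hW : HasLipschitzBoundary W) (R : ℝ) : arcLength (frontier W ∩ Metric.ball 0 R) < ⊤ := by
  obtain ⟨t, ρ, h, hsub⟩ := hW.exists_finite_cover R
  refine (measure_mono hsub).trans_lt ((measure_biUnion_finset_le _ _).trans_lt ?_)
  exact ENNReal.sum_lt_top.2 fun p hp => (h p hp).1

lemma HasLipschitzBoundary.aemeasurable_exteriorNormal {W : Set Plane}
    (hW : HasLipschitzBoundary W) (R : ℝ) :
    AEMeasurable (exteriorNormal W) (arcLength.restrict (frontier W ∩ Metric.ball 0 R)) := by
  obtain ⟨t, ρ, h, hsub⟩ := hW.exists_finite_cover R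
  refine AEMeasurable.mono_measure ?_ (Measure.restrict_mono hsub le_rfl)
  change AEMeasurable _ (arcLength.restrict (⋃ p ∈ (t : Set Plane), _))
  rw [biUnion_eq_iUnion]
  exact AEMeasurable.iUnion fun p => (h p p.2).2

/-! ### The quadratic form of the matrix `ω² E - g K` -/

lemma two_by_two_form_nonneg {a b d x y : ℝ} (ha : 0 ≤ a) (hb : 0 ≤ b) (h : d ^ 2 ≤ a * b) :
    0 ≤ a * x ^ 2 + b * y ^ 2 - 2 * d * x * y := by
  rcases ha.eq_or_lt with rfl | ha
  · have hd : d = 0 := by nlinarith [sq_nonneg d]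
    subst hd
    nlinarith [mul_nonneg hb (sq_nonneg y)]
  · have : 0 ≤ a * (a * x ^ 2 + b * y ^ 2 - 2 * d * x * y) := by
      nlinarith [sq_nonneg (a * x - d * y), mul_nonneg (sub_nonneg.2 h) (sq_nonneg y)]
    exact nonneg_of_mul_nonneg_right this ha

/-- If `s` is at least the largest root of the quadratic polynomial
`(l m - p) (l j - q) - d ^ 2`, then the corresponding quadratic form is nonnegative. -/
lemma pencil_form_nonneg {m j p q d s : ℝ} (hm : 0 < m) (hj : 0 < j)
    (hs : ∀ l, (l * m - p) * (l * j - q) - d ^ 2 = 0 → l ≤ s) (x y : ℝ) :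
    0 ≤ (s * m - p) * x ^ 2 + (s * j - q) * y ^ 2 - 2 * d * x * y := by
  -- With `u = p / m` and `v = q / j`, the roots of the polynomial are `(u + v) / 2 ± D`.
  set D := √((p / m - q / j) ^ 2 / 4 + d ^ 2 / (m * j)) with hD
  have hD0 : 0 ≤ D := Real.sqrt_nonneg _
  have hD2 : D ^ 2 = (p / m - q / j) ^ 2 / 4 + d ^ 2 / (m * j) :=
    Real.sq_sqrt (by positivity)
  set u := p / m with hu
  set v := q / j with hv
  have hp : p = u * m := by rw [hu]; field_simp
  have hq : q = v * j := by rw [hv]; field_simp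
  have hd : d ^ 2 = (D ^ 2 - (u - v) ^ 2 / 4) * (m * j) := by rw [hD2]; field_simp; ring
  have hl := hs ((u + v) / 2 + D) (by rw [hd, hp, hq]; ring)
  have hDuv : |u - v| / 2 ≤ D := by
    apply abs_le_of_sq_le_sq' _ hD0 |>.2
    rw [hD2, div_pow, sq_abs]
    have : 0 ≤ d ^ 2 / (m * j) := by positivity
    linarith
  have h1 := le_abs_self (u - v)
  have h2 := neg_abs_le (u - v)
  -- These nonnegative lower bounds have the product `D² - (u - v)² / 4 = d² / (m j)`, which is
  -- exactly what the determinant of the form requires.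
  have ha : D + (v - u) / 2 ≤ s - u := by linarith
  have hb : D + (u - v) / 2 ≤ s - v := by linarith
  refine two_by_two_form_nonneg ?_ ?_ ?_
  · rw [hp, ← sub_mul]; exact mul_nonneg (by linarith) hm.le
  · rw [hq, ← sub_mul]; exact mul_nonneg (by linarith) hj.le
  · have : (D + (v - u) / 2) * (D + (u - v) / 2) ≤ (s - u) * (s - v) :=
      mul_le_mul ha hb (by linarith) (by linarith)
    rw [hd, hp, hq]
    calc (D ^ 2 - (u - v) ^ 2 / 4) * (m * j)
        = (D + (v - u) / 2) * (D + (u - v) / 2) * (m * j) := by ring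
      _ ≤ (s - u) * (s - v) * (m * j) := by gcongr
      _ = _ := by ring

namespace FloatingSystem

variable {C : FloatingSystem}

/-! ### Positivity of the mass and of the moment of inertia -/

lemma IsAdmissible.immersed_isOpen (hC : C.IsAdmissible) : IsOpen C.immersed :=
  hC.body_open.inter (isOpen_lt (by fun_prop) continuous_const)

lemma IsAdmissible.volume_immersed_lt_top (hC : C.IsAdmissible) : volume C.immersed < ⊤ :=
  (hC.body_bounded.subset inter_subset_left).measure_lt_top

lemma IsAdmissible.massIM_pos (hC : C.IsAdmissible) (hE : C.IsEquilibrium) : 0 < C.massIM := by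
  rw [hE.archimedes, setIntegral_const, smul_eq_mul, mul_one, Measure.real]
  exact ENNReal.toReal_pos (hC.immersed_isOpen.measure_pos _ hC.immersed_connected.nonempty).ne'
    hC.volume_immersed_lt_top.ne

/-- If the moment were zero, the density would vanish almost everywhere outside the centre of mass,
and the mass would be zero. -/
lemma IsAdmissible.inertiaIM_pos (hC : C.IsAdmissible) (hE : C.IsEquilibrium) :
    0 < C.inertiaIM := by
  have hmass := hC.massIM_pos hE
  refine mul_pos (inv_pos.2 hC.waterDensity_pos) ?_
  set k : Plane → ℝ := fun p => (p 0 - C.x₀) ^ 2 + (p 1 - C.y₀) ^ 2 with hk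
  have hkc : Continuous k := by rw [hk]; fun_prop
  have hk0 : ∀ p, 0 ≤ k p := fun p => by positivity
  have hmeas := hC.body_open.measurableSet
  have hint : IntegrableOn (fun p => C.density p * k p) C.body := by
    obtain ⟨M, hM⟩ := (hC.body_bounded.isCompact_closure.exists_bound_of_continuousOn
      hkc.continuousOn)
    refine hC.density_integrable.mul_bdd (c := M) hkc.aestronglyMeasurable ?_
    filter_upwards [ae_restrict_mem hmeas] with p hp using hM p (subset_closure hp)
  have hnn : 0 ≤ᵐ[volume.restrict C.body] fun p => C.density p * k p := by
    filter_upwards [ae_restrict_mem hmeas] with p hp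
    exact mul_nonneg (hC.density_nonneg p hp) (hk0 p)
  refine lt_of_le_of_ne (integral_nonneg_of_ae hnn) fun h0 => ?_
  have hz := (integral_eq_zero_iff_of_nonneg_ae hnn hint).1 h0.symm
  have hne : ∀ᵐ p ∂volume.restrict C.body, p ≠ !₂[C.x₀, C.y₀] :=
    ae_restrict_of_ae (measure_eq_zero_iff_ae_notMem.1 (measure_singleton _))
  have : ∀ᵐ p ∂volume.restrict C.body, C.density p = 0 := by
    filter_upwards [hz, hne] with p hp hpne
    rcases mul_eq_zero.1 hp with h | h
    · exact h
    · refine absurd ?_ hpne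
      have h1 : p 0 - C.x₀ = 0 := by
        simp only [hk] at h; nlinarith [sq_nonneg (p 0 - C.x₀), sq_nonneg (p 1 - C.y₀)]
      have h2 : p 1 - C.y₀ = 0 := by
        simp only [hk] at h; nlinarith [sq_nonneg (p 0 - C.x₀), sq_nonneg (p 1 - C.y₀)]
      ext i
      fin_cases i
      · simpa using sub_eq_zero.1 h1
      · simpa using sub_eq_zero.1 h2
  rw [massIM, integral_eq_zero_of_ae this, mul_zero] at hmass
  exact lt_irrefl _ hmass

/-- The quadratic form of `ω² E - g K` dominates its first, decoupled, part. -/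
lemma surge_form_le_energy_form (hC : C.IsAdmissible) (hE : C.IsEquilibrium) {ω lam : ℝ}
    (hlam : IsGreatest {l : ℝ | (l • C.matE - C.gravity • C.matK).det = 0} lam)
    (hωlam : lam ≤ ω ^ 2) (χ : Fin 3 → ℝ) :
    ω ^ 2 * C.massIM * χ 0 ^ 2 ≤
      ω ^ 2 * (χ ⬝ᵥ (C.matE *ᵥ χ)) - C.gravity * (χ ⬝ᵥ (C.matK *ᵥ χ)) := by
  have hm := hC.massIM_pos hE
  have hj := hC.inertiaIM_pos hE
  -- The `3 × 3` determinant is `l I^M` times that of the lower block, so every root for the block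
  -- is a root of the whole pencil and is at most `lam`.
  have := pencil_form_nonneg (p := C.gravity * C.momentD)
    (q := C.gravity * (C.momentDxx + C.momentBy)) (d := C.gravity * C.momentDx) (s := ω ^ 2)
    hm hj (fun l hl => (hlam.2 (by
      rw [mem_ofPred_eq, det_fin_three]
      simp only [matE, matK, Matrix.sub_apply, Matrix.smul_apply,
        smul_eq_mul, of_apply, cons_val', cons_val_zero,
        cons_val_one, cons_val]
      linear_combination (l * C.massIM) * hl)).trans hωlam) (χ 1) (χ 2)
  simp only [matE, matK, dotProduct, mulVec, Fin.sum_univ_three, of_apply, cons_val', cons_val_zero,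
    cons_val_one, cons_val]
  linarith

end FloatingSystem

/-! ### An estimate of Hardy type along slanted lines -/

/-- The involution `(s, d) ↦ (s - d, -d)`. -/
def slant (z : ℝ × ℝ) : ℝ × ℝ := (z.1 - z.2, -z.2)

lemma slant_slant (z : ℝ × ℝ) : slant (slant z) = z := by simp [slant]

lemma measurePreserving_slant : MeasurePreserving slant volume volume := by
  have h := MeasurePreserving.skew_product (μa := (volume : Measure ℝ))
    (μc := (volume : Measure ℝ)) (μd := (volume : Measure ℝ))
    (Measure.measurePreserving_neg (volume : Measure ℝ)) (g := fun d s => s - d)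
    (by simp only [Function.uncurry_def]; fun_prop)
    (ae_of_all _ fun d => (measurePreserving_sub_right volume d).map_eq)
  exact (Measure.measurePreserving_swap.comp h).comp Measure.measurePreserving_swap

lemma measurableEmbedding_slant : MeasurableEmbedding slant :=
  (Homeomorph.mk (Equiv.mk slant slant slant_slant slant_slant)
    (by change Continuous slant; unfold slant; fun_prop)
    (by change Continuous slant; unfold slant; fun_prop)).measurableEmbedding

lemma enorm_add_sq_le (x y : ℝ) : ‖x + y‖ₑ ^ 2 ≤ 2 * ‖x‖ₑ ^ 2 + 2 * ‖y‖ₑ ^ 2 := by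
  simp only [← enorm_pow]
  rw [show (2 : ENNReal) = ‖(2 : ℝ)‖ₑ by simp [enorm_eq_nnnorm], ← enorm_mul, ← enorm_mul,
    Real.enorm_of_nonneg (by positivity), Real.enorm_of_nonneg (by positivity),
    Real.enorm_of_nonneg (by positivity), ← ENNReal.ofReal_add (by positivity) (by positivity)]
  exact ENNReal.ofReal_le_ofReal (by nlinarith [sq_nonneg (x - y)])

lemma enorm_sq_integral_le {w : ℝ → ℝ} (hw : Continuous w) {d : ℝ} (hd : 0 ≤ d) :
    ‖∫ τ in (0 : ℝ)..d, w τ‖ₑ ^ 2 ≤ ENNReal.ofReal d * ∫⁻ τ in Ioc 0 d, ‖w τ‖ₑ ^ 2 := by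
  rw [intervalIntegral.integral_of_le hd]
  have h1 : ‖∫ τ in Ioc 0 d, w τ‖ₑ ≤ ∫⁻ τ in Ioc 0 d, ‖w τ‖ₑ := enorm_integral_le_lintegral_enorm _
  have h2 := ENNReal.lintegral_mul_le_Lp_mul_Lq (volume.restrict (Ioc 0 d))
    (Real.HolderConjugate.two_two) (f := fun _ => 1) (g := fun τ => ‖w τ‖ₑ)
    aemeasurable_const hw.enorm.aemeasurable
  simp only [Pi.mul_apply, one_mul, ENNReal.one_rpow, lintegral_const, Measure.restrict_apply_univ,
    Real.volume_Ioc, sub_zero] at h2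
  calc ‖∫ τ in Ioc 0 d, w τ‖ₑ ^ 2 ≤ (ENNReal.ofReal d ^ (1 / 2 : ℝ) *
        (∫⁻ τ in Ioc 0 d, ‖w τ‖ₑ ^ (2 : ℝ)) ^ (1 / 2 : ℝ)) ^ 2 := by
        gcongr; exact h1.trans h2
    _ = _ := by
        rw [mul_pow, ← ENNReal.rpow_natCast, ← ENNReal.rpow_mul, ← ENNReal.rpow_natCast,
          ← ENNReal.rpow_mul]
        norm_num

section Slanted

variable {v : ℝ × ℝ → ℝ}

/-- The fundamental theorem of calculus along the line from `(s, 0)` to `slant (s, d)`, then the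
Cauchy–Schwarz inequality. Slanted lines from distant points of the free surface also reach the
water beneath the body, where vertical ones would meet the body. -/
lemma enorm_sq_slant_le (hv : ContDiff ℝ 1 v) (s : ℝ) {d : ℝ} (hd : 0 ≤ d) :
    ‖v (slant (s, d))‖ₑ ^ 2 ≤ 2 * ‖v (s, 0)‖ₑ ^ 2 +
      2 * (ENNReal.ofReal d * ∫⁻ τ in Ioc 0 d, ‖fderiv ℝ v (slant (s, τ)) (1, 1)‖ₑ ^ 2) := by
  have hder : ∀ τ, HasDerivAt (fun τ => v (slant (s, τ)))
      (-(fderiv ℝ v (slant (s, τ)) (1, 1))) τ := by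
    intro τ
    have h1 : HasDerivAt (fun τ : ℝ => slant (s, τ)) (-1, -1) τ :=
      ((hasDerivAt_id τ).const_sub s).prodMk (hasDerivAt_id τ).neg
    have h2 := ((hv.differentiable one_ne_zero) (slant (s, τ))).hasFDerivAt.comp_hasDerivAt τ h1
    have : ((-1, -1) : ℝ × ℝ) = -(1, 1) := by simp
    rw [this, map_neg] at h2
    exact h2
  have hc : Continuous fun τ : ℝ => fderiv ℝ v (slant (s, τ)) (1, 1) :=
    (continuous_fderiv_apply_const hv (1, 1)).comp (by unfold slant; fun_prop)
  have hftc := intervalIntegral.integral_eq_sub_of_hasDerivAt (a := 0) (b := d)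
    (fun τ _ => hder τ) (hc.neg.intervalIntegrable _ _)
  have h0 : slant (s, 0) = (s, 0) := by simp [slant]
  have : v (slant (s, d)) = v (s, 0) + -∫ τ in (0 : ℝ)..d, fderiv ℝ v (slant (s, τ)) (1, 1) := by
    rw [← intervalIntegral.integral_neg, hftc, h0]; ring
  rw [this]
  refine (enorm_add_sq_le _ _).trans ?_
  rw [enorm_neg]
  gcongr
  exact enorm_sq_integral_le hc hd

/-- The part of the quadrant `x ≥ 0`, `y < 0` of depth `h` with `a < x - y < b`. -/
def slantedStrip (h : WithTop ℝ) (a b : ℝ) : Set (ℝ × ℝ) :=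
  {z | 0 ≤ z.1 ∧ z.2 < 0 ∧ ((-z.2 : ℝ) : WithTop ℝ) < h ∧ a < z.1 - z.2 ∧ z.1 - z.2 < b}

lemma measurableSet_coe_lt (h : WithTop ℝ) : MeasurableSet {y : ℝ | (y : WithTop ℝ) < h} := by
  induction h with
  | top => simp
  | coe h => simp only [WithTop.coe_lt_coe]; exact measurableSet_Iio

lemma measurableSet_slantedStrip (h : WithTop ℝ) (a b : ℝ) :
    MeasurableSet (slantedStrip h a b) := by
  have hm : Measurable fun z : ℝ × ℝ => z.1 - z.2 := by fun_prop
  exact (measurableSet_le measurable_const measurable_fst).inter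
    ((measurableSet_lt measurable_snd measurable_const).inter
      (((measurable_neg.comp measurable_snd) (measurableSet_coe_lt h)).inter
        ((measurableSet_lt measurable_const hm).inter (measurableSet_lt hm measurable_const))))

/-- Fubini's theorem in the coordinates `s = x - y`, the foot of the slanted line on the `x`-axis,
and `d = -y`, the depth. -/
lemma lintegral_slantedStrip (h : WithTop ℝ) {a b : ℝ} {w : ℝ × ℝ → ENNReal} (hw : Measurable w) :
    ∫⁻ z in slantedStrip h a b, w z =
      ∫⁻ s in Ioo a b, ∫⁻ d in {d | 0 < d ∧ d ≤ s ∧ (d : WithTop ℝ) < h}, w (slant (s, d)) := by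
  rw [← measurePreserving_slant.setLIntegral_comp_preimage_emb measurableEmbedding_slant,
    ← lintegral_indicator (measurePreserving_slant.measurable (measurableSet_slantedStrip h a b)),
    Measure.volume_eq_prod, lintegral_prod, ← lintegral_indicator measurableSet_Ioo]
  · refine lintegral_congr fun s => ?_
    have hD : MeasurableSet {d : ℝ | 0 < d ∧ d ≤ s ∧ (d : WithTop ℝ) < h} :=
      measurableSet_Ioi.inter (measurableSet_Iic.inter (measurableSet_coe_lt h))
    by_cases hs : s ∈ Ioo a b
    · rw [indicator_of_mem hs, ← lintegral_indicator hD]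
      refine lintegral_congr fun d => ?_
      by_cases hd : d ∈ {d : ℝ | 0 < d ∧ d ≤ s ∧ (d : WithTop ℝ) < h}
      · rw [indicator_of_mem hd, indicator_of_mem]
        refine ⟨?_, ?_, ?_, ?_, ?_⟩
        · simpa [slant] using hd.2.1
        · simpa [slant] using hd.1
        · simpa [slant] using hd.2.2
        · simpa [slant] using hs.1
        · simpa [slant] using hs.2
      · rw [indicator_of_notMem hd, indicator_of_notMem]
        rintro ⟨h1, h2, h3, h4, h5⟩
        simp only [slant, sub_nonneg, neg_neg, Left.neg_neg_iff] at h1 h2 h3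
        exact hd ⟨h2, h1, h3⟩
    · rw [indicator_of_notMem hs]
      refine (lintegral_congr fun d => ?_).trans lintegral_zero
      rw [indicator_of_notMem]
      rintro ⟨h1, h2, h3, h4, h5⟩
      simp only [slant, sub_neg_eq_add, sub_add_cancel] at h4 h5
      exact hs ⟨h4, h5⟩
  · exact ((hw.comp measurePreserving_slant.measurable).indicator
      (measurePreserving_slant.measurable (measurableSet_slantedStrip h a b))).aemeasurable

/-- On each line the pointwise bound does not depend on `d`, and `d` ranges over a set of measure at
most `b`; hence one factor `b` for the surface term and two for the gradient term. -/
lemma lintegral_slantedStrip_le (hv : ContDiff ℝ 1 v) (h : WithTop ℝ) {a b : ℝ} (ha : 0 ≤ a) :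
    ∫⁻ z in slantedStrip h a b, ‖v z‖ₑ ^ 2 ≤
      ENNReal.ofReal (2 * b) * (∫⁻ s in Ioo a b, ‖v (s, 0)‖ₑ ^ 2) +
        ENNReal.ofReal (2 * b ^ 2) *
          ∫⁻ z in slantedStrip h a b, ‖fderiv ℝ v z (1, 1)‖ₑ ^ 2 := by
  have hvc := hv.continuous
  have hfc := continuous_fderiv_apply_const hv (1, 1)
  have hvm : Measurable fun s : ℝ => ‖v (s, 0)‖ₑ ^ 2 :=
    ((hvc.comp (by fun_prop : Continuous fun s : ℝ => (s, (0 : ℝ)))).enorm.measurable.pow_const 2)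
  have hslant : Continuous slant := by unfold slant; fun_prop
  rw [lintegral_slantedStrip h (by fun_prop), lintegral_slantedStrip h (by fun_prop),
    ← lintegral_const_mul' _ _ ENNReal.ofReal_ne_top,
    ← lintegral_const_mul' _ _ ENNReal.ofReal_ne_top, ← lintegral_add_left (hvm.const_mul _)]
  refine setLIntegral_mono' measurableSet_Ioo fun s hs => ?_
  set D := {d : ℝ | 0 < d ∧ d ≤ s ∧ (d : WithTop ℝ) < h} with hD
  have hs0 : 0 < s := lt_of_le_of_lt ha hs.1
  have hb0 : 0 < b := hs0.trans hs.2
  have hDm : MeasurableSet D :=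
    measurableSet_Ioi.inter (measurableSet_Iic.inter (measurableSet_coe_lt h))
  have hDv : volume D ≤ ENNReal.ofReal b := by
    refine (measure_mono (t := Ioc 0 b) fun d hd => ⟨hd.1, hd.2.1.trans hs.2.le⟩).trans ?_
    simp
  set J := ∫⁻ d in D, ‖fderiv ℝ v (slant (s, d)) (1, 1)‖ₑ ^ 2 with hJ
  have hpt : ∀ d ∈ D, ‖v (slant (s, d))‖ₑ ^ 2 ≤
      2 * ‖v (s, 0)‖ₑ ^ 2 + 2 * (ENNReal.ofReal b * J) := by
    intro d hd
    refine (enorm_sq_slant_le hv s hd.1.le).trans ?_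
    gcongr
    · exact hd.2.1.trans hs.2.le
    -- The segment from the surface down to depth `d` stays in the strip, and above the bottom.
    · refine lintegral_mono_set fun τ hτ => ⟨hτ.1, hτ.2.trans hd.2.1, ?_⟩
      exact lt_of_le_of_lt (WithTop.coe_le_coe.2 hτ.2) hd.2.2
  calc ∫⁻ d in D, ‖v (slant (s, d))‖ₑ ^ 2
      ≤ ∫⁻ d in D, (2 * ‖v (s, 0)‖ₑ ^ 2 + 2 * (ENNReal.ofReal b * J)) :=
        setLIntegral_mono' hDm hpt
    _ = (2 * ‖v (s, 0)‖ₑ ^ 2 + 2 * (ENNReal.ofReal b * J)) * volume D := by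
        rw [setLIntegral_const]
    _ ≤ (2 * ‖v (s, 0)‖ₑ ^ 2 + 2 * (ENNReal.ofReal b * J)) * ENNReal.ofReal b := by gcongr
    _ = _ := by
        rw [ENNReal.ofReal_mul zero_le_two, ENNReal.ofReal_mul zero_le_two,
          ENNReal.ofReal_pow hb0.le]
        simp only [ENNReal.ofReal_ofNat]
        ring

end Slanted

/-! ### The estimate in annuli of the water domain -/

/-- The standard basis of the plane. -/
abbrev stdBasis : OrthonormalBasis (Fin 2) ℝ Plane := EuclideanSpace.basisFun (Fin 2) ℝ

lemma inner_stdBasis (i : Fin 2) (q : Plane) : ⟪stdBasis i, q⟫_ℝ = q i := by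
  simp [PiLp.inner_apply]

lemma frame_stdBasis_zero (z : ℝ × ℝ) : frame stdBasis z 0 = z.1 := by
  rw [← inner_stdBasis, inner_frame_zero]

lemma frame_stdBasis_one (z : ℝ × ℝ) : frame stdBasis z 1 = z.2 := by
  rw [← inner_stdBasis, inner_frame_one]

/-- In this frame the half `x ≤ 0` of the water becomes the half in which the slanted strips are
defined. -/
lemma exists_reflected_frame : ∃ e : OrthonormalBasis (Fin 2) ℝ Plane,
    (∀ q : Plane, ⟪e 1, q⟫_ℝ = q 1) ∧ ∀ q : Plane, ⟪e 0, q⟫_ℝ = -q 0 := by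
  set T : Plane ≃ₗᵢ[ℝ] Plane := LinearIsometryEquiv.piLpCongrRight 2
    ![LinearIsometryEquiv.neg ℝ, LinearIsometryEquiv.refl ℝ ℝ] with hT
  have h0 : ∀ q : Plane, ⟪(stdBasis.map T) 0, q⟫_ℝ = -q 0 := by
    intro q
    simp [hT, PiLp.inner_apply]
  have h1 : ∀ q : Plane, ⟪(stdBasis.map T) 1, q⟫_ℝ = q 1 := by
    intro q
    simp [hT, PiLp.inner_apply]
  exact ⟨stdBasis.map T, h1, h0⟩

lemma isometry_frame_horizontal (e : OrthonormalBasis (Fin 2) ℝ Plane) :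
    Isometry fun s : ℝ => frame e (s, 0) := by
  refine Isometry.of_dist_eq fun s t => ?_
  rw [dist_eq_norm, frame_sub, Real.dist_eq, ← abs_of_nonneg (norm_nonneg _),
    ← sq_eq_sq_iff_abs_eq_abs,
    norm_frame_sq]
  simp

/-- Compares Lebesgue integrals along the `x`-axis with arc length integrals over `F`; only this
direction is needed. -/
lemma map_restrict_le_arcLength {ι : ℝ → Plane} (hι : Isometry ι) {I : Set ℝ} {T : Set Plane}
    (hI : MeasurableSet I) (hIT : ∀ s ∈ I, ι s ∈ T) :
    (volume.restrict I).map ι ≤ arcLength.restrict T := by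
  refine Measure.le_iff.2 fun A hA => ?_
  rw [Measure.map_apply hι.continuous.measurable hA, Measure.restrict_apply hA,
    Measure.restrict_apply' hI, ← hausdorffMeasure_real,
    ← hι.hausdorffMeasure_image (Or.inl zero_le_one)]
  refine measure_mono ?_
  rintro _ ⟨s, ⟨hs, hsI⟩, rfl⟩
  exact ⟨hs, hIT s hsI⟩

namespace FloatingSystem

variable {C : FloatingSystem}

lemma IsAdmissible.exists_body_subset (hC : C.IsAdmissible) :
    ∃ R > 0, closure C.body ⊆ Metric.closedBall 0 R := by
  obtain ⟨R, hR⟩ := hC.body_bounded.subset_closedBall 0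
  refine ⟨max R 1, by positivity, closure_minimal ?_ Metric.isClosed_closedBall⟩
  exact hR.trans (Metric.closedBall_subset_closedBall (le_max_left _ _))

lemma IsAdmissible.measurableSet_water (hC : C.IsAdmissible) : MeasurableSet C.water :=
  hC.water_lipschitz.isOpen.measurableSet

lemma measurableSet_freeSurface : MeasurableSet C.freeSurface :=
  (measurableSet_eq_fun (by fun_prop) measurable_const).diff isClosed_closure.measurableSet

lemma measurableSet_wetted : MeasurableSet C.wetted :=
  isClosed_frontier.measurableSet.inter (measurableSet_lt (by fun_prop) measurable_const)

/-- In the strip `|x| + |y| > R / 2 ≥ 2 R₀`, which excludes the closed body in the disc of radius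
`R₀`, and `|x| + |y| < 5 R`, which keeps the strip in the ball of radius `6 R`. -/
lemma lintegral_image_slantedStrip_le {e : OrthonormalBasis (Fin 2) ℝ Plane}
    (he : ∀ q : Plane, ⟪e 1, q⟫_ℝ = q 1) {R₀ R : ℝ} (hR₀ : closure C.body ⊆ Metric.closedBall 0 R₀)
    (hR : 4 * R₀ ≤ R) (hR1 : 1 ≤ R) {u : Plane → ℝ} (hu : ContDiff ℝ 1 u) :
    ∫⁻ p in frame e '' slantedStrip C.depth (R / 2) (5 * R), ‖u p‖ₑ ^ 2 ≤
      ENNReal.ofReal (200 * R ^ 2) *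
        ((∫⁻ p in C.freeSurface ∩ Metric.ball 0 (6 * R), ‖u p‖ₑ ^ 2 ∂arcLength) +
          ∫⁻ p in C.water ∩ Metric.ball 0 (6 * R), ‖gradient u p‖ₑ ^ 2) := by
  set A := slantedStrip C.depth (R / 2) (5 * R) with hA
  have hmp := measurePreserving_frame e
  have hme := measurableEmbedding_frame e
  have hpre : frame e ⁻¹' (frame e '' A) = A := (frame_injective e).preimage_image _
  have key : ∀ F : Plane → ENNReal, ∫⁻ p in frame e '' A, F p = ∫⁻ z in A, F (frame e z) := by
    intro F
    rw [← hmp.setLIntegral_comp_preimage_emb hme, hpre]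
  have hW : frame e '' A ⊆ C.water ∩ Metric.ball 0 (6 * R) := by
    rintro _ ⟨z, ⟨h1, h2, h3, h4, h5⟩, rfl⟩
    have hy : (frame e z) 1 = z.2 := by rw [← he, inner_frame_one]
    refine ⟨⟨⟨by simpa only [hy] using h2, by simpa only [hy] using h3⟩, fun hcl => ?_⟩, ?_⟩
    · have := hR₀ (closure_mono inter_subset_left hcl)
      rw [mem_closedBall_zero_iff] at this
      have e1 := (le_abs_self _).trans (abs_fst_le_norm_frame e z)
      have e2 := (neg_le_abs _).trans (abs_snd_le_norm_frame e z)
      linarith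
    · rw [mem_ball_zero_iff]
      have := norm_frame_le e z
      rw [abs_of_nonneg h1, abs_of_neg h2] at this
      linarith
  have hF : ∀ s ∈ Ioo (R / 2) (5 * R), frame e (s, 0) ∈ C.freeSurface ∩ Metric.ball 0 (6 * R) := by
    intro s hs
    have hs0 : 0 < s := by linarith [hs.1]
    refine ⟨⟨?_, fun hcl => ?_⟩, ?_⟩
    · rw [mem_ofPred_eq, ← he, inner_frame_one]
    · have := hR₀ (closure_mono inter_subset_left hcl)
      rw [mem_closedBall_zero_iff] at this
      have e1 := (le_abs_self _).trans (abs_fst_le_norm_frame e (s, 0))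
      simp only at e1
      linarith [hs.1]
    · rw [mem_ball_zero_iff]
      have := norm_frame_le e (s, 0)
      simp only [abs_zero, add_zero, abs_of_pos hs0] at this
      linarith [hs.2]
  have hv : ContDiff ℝ 1 fun z => u (frame e z) := hu.comp (contDiff_frame e)
  have hud := hu.differentiable one_ne_zero
  rw [key]
  refine (lintegral_slantedStrip_le hv C.depth (by linarith)).trans ?_
  have hX : ∫⁻ s in Ioo (R / 2) (5 * R), ‖u (frame e (s, 0))‖ₑ ^ 2 ≤
      ∫⁻ p in C.freeSurface ∩ Metric.ball 0 (6 * R), ‖u p‖ₑ ^ 2 ∂arcLength := by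
    have hi := isometry_frame_horizontal e
    have hcont := hu.continuous
    have := lintegral_map (μ := volume.restrict (Ioo (R / 2) (5 * R)))
      (f := fun p => ‖u p‖ₑ ^ 2) (by fun_prop) hi.continuous.measurable
    rw [← this]
    exact lintegral_mono' (map_restrict_le_arcLength hi measurableSet_Ioo hF) le_rfl
  have hY : ∫⁻ z in A, ‖fderiv ℝ (fun w => u (frame e w)) z (1, 1)‖ₑ ^ 2 ≤
      2 * ∫⁻ p in C.water ∩ Metric.ball 0 (6 * R), ‖gradient u p‖ₑ ^ 2 := by
    refine le_trans ?_ (mul_le_mul_right (lintegral_mono_set hW) _)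
    rw [← lintegral_const_mul' _ _ ENNReal.ofNat_ne_top, key]
    refine lintegral_mono fun z => ?_
    rw [fderiv_comp_frame e hud]
    have h1 : ‖⟪gradient u (frame e z), frame e (1, 1)⟫_ℝ‖ ^ 2 ≤
        2 * ‖gradient u (frame e z)‖ ^ 2 := by
      calc _ ≤ (‖gradient u (frame e z)‖ * ‖frame e (1, 1)‖) ^ 2 := by
            gcongr; exact norm_inner_le_norm _ _
        _ = _ := by rw [mul_pow, norm_frame_sq]; ring
    have h2 := ENNReal.ofReal_le_ofReal h1
    rwa [ENNReal.ofReal_mul zero_le_two, ENNReal.ofReal_pow (norm_nonneg _),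
      ENNReal.ofReal_pow (norm_nonneg _), ofReal_norm, ofReal_norm,
      ENNReal.ofReal_ofNat] at h2
  rw [mul_add]
  -- With `b = 5 R` the two constants are `10 R`, where `1 ≤ R` is used, and `2 · 50 R²`, the extra
  -- `2` being `|(1, 1)|²`.
  have c1 : ENNReal.ofReal (2 * (5 * R)) ≤ ENNReal.ofReal (200 * R ^ 2) :=
    ENNReal.ofReal_le_ofReal (by nlinarith)
  have c2 : ENNReal.ofReal (2 * (5 * R) ^ 2) * 2 ≤ ENNReal.ofReal (200 * R ^ 2) := by
    rw [show (2 : ENNReal) = ENNReal.ofReal 2 by simp, ← ENNReal.ofReal_mul (by positivity)]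
    exact ENNReal.ofReal_le_ofReal (by nlinarith)
  refine add_le_add (mul_le_mul' c1 hX) ?_
  refine (mul_le_mul_right hY _).trans ?_
  rw [← mul_assoc]
  gcongr

lemma eLpNorm_two_sq {α E : Type*} [MeasurableSpace α] [NormedAddCommGroup E] (f : α → E)
    (μ : Measure α) : eLpNorm f 2 μ ^ 2 = ∫⁻ x, ‖f x‖ₑ ^ 2 ∂μ := by
  have := eLpNorm_nnreal_pow_eq_lintegral (μ := μ) (f := f) (p := 2) two_ne_zero
  simpa using this

/-- The part of the water domain in the annulus `R ≤ |p| ≤ 2 R`. -/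
def waterAnnulus (C : FloatingSystem) (R : ℝ) : Set Plane :=
  C.water ∩ {p | R ≤ ‖p‖ ∧ ‖p‖ ≤ 2 * R}

/-- Since `R ≤ |x| + |y| ≤ 4 R` in the annulus, the strips on the two sides cover it; twice `200 R²`
is `(20 R)²`. -/
lemma eLpNorm_waterAnnulus_le {R₀ R : ℝ} (hR₀ : closure C.body ⊆ Metric.closedBall 0 R₀)
    (hR : 4 * R₀ ≤ R) (hR1 : 1 ≤ R) {u : Plane → ℝ} (hu : ContDiff ℝ 1 u) :
    eLpNorm u 2 (volume.restrict (C.waterAnnulus R)) ≤ ENNReal.ofReal (20 * R) *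
      (eLpNorm u 2 (arcLength.restrict (C.freeSurface ∩ Metric.ball 0 (6 * R))) +
        eLpNorm (gradient u) 2 (volume.restrict (C.water ∩ Metric.ball 0 (6 * R)))) := by
  obtain ⟨e, he, he0⟩ := exists_reflected_frame
  have h1 := lintegral_image_slantedStrip_le he hR₀ hR hR1 hu
  have h2 := lintegral_image_slantedStrip_le (inner_stdBasis 1) hR₀ hR hR1 hu
  have hcover : C.waterAnnulus R ⊆ frame e '' slantedStrip C.depth (R / 2) (5 * R) ∪
      frame stdBasis '' slantedStrip C.depth (R / 2) (5 * R) := by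
    rintro q ⟨⟨⟨hq1, hq2⟩, -⟩, hq3, hq4⟩
    have hn := norm_frame_le stdBasis (⟪stdBasis 0, q⟫_ℝ, ⟪stdBasis 1, q⟫_ℝ)
    have ha := abs_fst_le_norm_frame stdBasis (⟪stdBasis 0, q⟫_ℝ, ⟪stdBasis 1, q⟫_ℝ)
    have hb := abs_snd_le_norm_frame stdBasis (⟪stdBasis 0, q⟫_ℝ, ⟪stdBasis 1, q⟫_ℝ)
    rw [frame_inner] at hn ha hb
    simp only [inner_stdBasis] at hn ha hb
    have hq1' : q 1 < 0 := hq1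
    rw [abs_of_neg hq1'] at hn hb
    rcases le_total 0 (q 0) with h0 | h0
    · right
      refine ⟨_, ?_, frame_inner stdBasis q⟩
      rw [abs_of_nonneg h0] at hn ha
      simp only [slantedStrip, inner_stdBasis, mem_ofPred_eq]
      exact ⟨h0, hq1, hq2, by linarith, by linarith⟩
    · left
      refine ⟨_, ?_, frame_inner e q⟩
      rw [abs_of_nonpos h0] at hn ha
      simp only [slantedStrip, he0, he, mem_ofPred_eq]
      exact ⟨by linarith, hq1, hq2, by linarith, by linarith⟩
  have h3 := (lintegral_mono_set hcover).trans (lintegral_union_le (fun p => ‖u p‖ₑ ^ 2) _ _)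
    |>.trans (add_le_add h1 h2)
  rw [← two_mul, ← mul_assoc] at h3
  simp only [← eLpNorm_two_sq] at h3
  set x := eLpNorm u 2 (arcLength.restrict (C.freeSurface ∩ Metric.ball 0 (6 * R)))
  set y := eLpNorm (gradient u) 2 (volume.restrict (C.water ∩ Metric.ball 0 (6 * R)))
  have hc : 2 * ENNReal.ofReal (200 * R ^ 2) = ENNReal.ofReal (20 * R) ^ 2 := by
    rw [show (2 : ENNReal) = ENNReal.ofReal 2 by simp, ← ENNReal.ofReal_mul (by positivity),
      ← ENNReal.ofReal_pow (by positivity)]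
    congr 1; ring
  have hxy : x ^ 2 + y ^ 2 ≤ (x + y) ^ 2 := by
    rw [show (x + y) ^ 2 = x ^ 2 + y ^ 2 + 2 * x * y by ring]
    exact le_self_add
  rw [hc] at h3
  have h4 := h3.trans (mul_le_mul_right hxy _)
  rw [← mul_pow] at h4
  exact (ENNReal.pow_right_strictMono two_ne_zero).le_iff_le.1 h4

/-- Functions of the energy space satisfy the estimate in annuli. -/
lemma MemEnergySpace.eLpNorm_waterAnnulus_le (hC : C.IsAdmissible) {φ : Plane → ℝ}
    {G : Plane → Plane} {t : Plane → ℝ} (h : C.MemEnergySpace φ G t) {R₀ R : ℝ}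
    (hR₀ : closure C.body ⊆ Metric.closedBall 0 R₀) (hR : 4 * R₀ ≤ R) (hR1 : 1 ≤ R) :
    eLpNorm φ 2 (volume.restrict (C.waterAnnulus R)) ≤ ENNReal.ofReal (20 * R) *
      (eLpNorm t 2 (arcLength.restrict C.freeSurface) +
        eLpNorm G 2 (volume.restrict C.water)) := by
  obtain ⟨u, hu, hlim⟩ := h.trace.approx
  obtain ⟨l1, l2, l3⟩ := hlim (6 * R)
  set μ := volume.restrict (C.water ∩ Metric.ball 0 (6 * R)) with hμ
  set σ := arcLength.restrict (frontier C.water ∩ Metric.ball 0 (6 * R)) with hσ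
  set κ := ENNReal.ofReal (20 * R)
  have hAμ : volume.restrict (C.waterAnnulus R) ≤ μ := by
    refine Measure.restrict_mono (inter_subset_inter_right _ fun p hp => ?_) le_rfl
    rw [mem_ball_zero_iff]
    linarith [hp.2]
  have hFσ : arcLength.restrict (C.freeSurface ∩ Metric.ball 0 (6 * R)) ≤ σ :=
    Measure.restrict_mono (inter_subset_inter_left _ hC.freeSurface_subset) le_rfl
  have mφ : AEStronglyMeasurable φ μ := (h.loc.memLp _).1
  have mG : AEStronglyMeasurable G μ := (h.loc.memLp_grad _).1
  have mt : AEStronglyMeasurable t σ := (h.trace.memLp _).1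
  have muc : ∀ k, Continuous (u k) := fun k => (hu k).continuous
  have mgc : ∀ k, Continuous (gradient (u k)) := fun k =>
    (InnerProductSpace.toDual ℝ Plane).symm.continuous.comp
      ((hu k).continuous_fderiv (by simp))
  -- The estimate holds for the smooth approximants; the triangle inequality isolates differences
  -- that tend to zero.
  have key : ∀ k, eLpNorm φ 2 (volume.restrict (C.waterAnnulus R)) ≤
      eLpNorm (fun p => u k p - φ p) 2 μ + κ * (eLpNorm (fun p => u k p - t p) 2 σ +
        eLpNorm t 2 (arcLength.restrict C.freeSurface) +
        (eLpNorm (fun p => gradient (u k) p - G p) 2 μ +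
          eLpNorm G 2 (volume.restrict C.water))) := by
    intro k
    have e1 : eLpNorm φ 2 (volume.restrict (C.waterAnnulus R)) ≤
        eLpNorm (fun p => u k p - φ p) 2 μ +
          eLpNorm (u k) 2 (volume.restrict (C.waterAnnulus R)) := by
      have : φ = u k - fun p => u k p - φ p := by ext p; simp
      conv_lhs => rw [this]
      refine (eLpNorm_sub_le (muc k).aestronglyMeasurable
        (((muc k).aestronglyMeasurable.sub mφ).mono_measure hAμ) one_le_two).trans ?_
      rw [add_comm]
      exact add_le_add (eLpNorm_mono_measure _ hAμ) le_rfl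
    have e2 : eLpNorm (u k) 2 (arcLength.restrict (C.freeSurface ∩ Metric.ball 0 (6 * R))) ≤
        eLpNorm (fun p => u k p - t p) 2 σ +
          eLpNorm t 2 (arcLength.restrict C.freeSurface) := by
      have : u k = (fun p => u k p - t p) + t := by ext p; simp
      conv_lhs => rw [this]
      refine (eLpNorm_add_le (((muc k).aestronglyMeasurable.sub mt).mono_measure hFσ)
        (mt.mono_measure hFσ) one_le_two).trans ?_
      exact add_le_add (eLpNorm_mono_measure _ hFσ)
        (eLpNorm_mono_measure _ (Measure.restrict_mono inter_subset_left le_rfl))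
    have e3 : eLpNorm (gradient (u k)) 2 μ ≤
        eLpNorm (fun p => gradient (u k) p - G p) 2 μ +
          eLpNorm G 2 (volume.restrict C.water) := by
      have : gradient (u k) = (fun p => gradient (u k) p - G p) + G := by ext p; simp
      conv_lhs => rw [this]
      refine (eLpNorm_add_le ((mgc k).aestronglyMeasurable.sub mG) mG one_le_two).trans ?_
      exact add_le_add le_rfl
        (eLpNorm_mono_measure _ (Measure.restrict_mono inter_subset_left le_rfl))
    refine e1.trans (add_le_add le_rfl ((FloatingSystem.eLpNorm_waterAnnulus_le hR₀ hR hR1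
      ((hu k).of_le (by simp))).trans ?_))
    gcongr
  have hT := l1.add (ENNReal.Tendsto.const_mul (a := κ)
    ((l3.add_const (eLpNorm t 2 (arcLength.restrict C.freeSurface))).add
      (l2.add_const (eLpNorm G 2 (volume.restrict C.water)))) (Or.inr ENNReal.ofReal_ne_top))
  simp only [zero_add] at hT
  exact ge_of_tendsto' hT key

end FloatingSystem

/-! ### Products of square integrable functions -/

section Products

variable {α E : Type*} [MeasurableSpace α] [NormedAddCommGroup E] [InnerProductSpace ℝ E]
  {μ : Measure α}

lemma eLpNorm_inner_le {f g : α → E} (hf : AEStronglyMeasurable f μ)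
    (hg : AEStronglyMeasurable g μ) :
    eLpNorm (fun x => ⟪f x, g x⟫_ℝ) 1 μ ≤ eLpNorm f 2 μ * eLpNorm g 2 μ := by
  have := eLpNorm_le_eLpNorm_mul_eLpNorm'_of_norm (p := 2) (q := 2) (r := 1) hf hg
    (fun x y => ⟪x, y⟫_ℝ) 1 (ae_of_all _ fun x => by
      simpa using norm_inner_le_norm (𝕜 := ℝ) (f x) (g x))
  simpa using this

lemma integrable_inner_of_memLp {f g : α → E} (hf : MemLp f 2 μ) (hg : MemLp g 2 μ) :
    Integrable (fun x => ⟪f x, g x⟫_ℝ) μ :=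
  memLp_one_iff_integrable.1 ⟨hf.1.inner hg.1,
    (eLpNorm_inner_le hf.1 hg.1).trans_lt (ENNReal.mul_lt_top hf.2 hg.2)⟩

lemma tendsto_integral_inner {f g : α → E} {gk : ℕ → α → E} (hf : MemLp f 2 μ) (hg : MemLp g 2 μ)
    (hgk : ∀ k, MemLp (gk k) 2 μ)
    (hlim : Tendsto (fun k => eLpNorm (fun x => gk k x - g x) 2 μ) atTop (𝓝 0)) :
    Tendsto (fun k => ∫ x, ⟪f x, gk k x⟫_ℝ ∂μ) atTop (𝓝 (∫ x, ⟪f x, g x⟫_ℝ ∂μ)) := by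
  refine tendsto_integral_of_L1' _ (hf.1.inner hg.1)
    (Eventually.of_forall fun k => integrable_inner_of_memLp hf (hgk k)) ?_
  have h1 : Tendsto (fun k => eLpNorm f 2 μ * eLpNorm (fun x => gk k x - g x) 2 μ) atTop (𝓝 0) := by
    simpa using ENNReal.Tendsto.const_mul hlim (Or.inr hf.2.ne)
  refine tendsto_of_tendsto_of_tendsto_of_le_of_le tendsto_const_nhds h1 (fun _ => zero_le)
    fun k => ?_
  have h2 := eLpNorm_inner_le (μ := μ) hf.1 ((hgk k).1.sub hg.1)
  refine le_trans (le_of_eq ?_) h2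
  congr 1
  ext x
  simp [inner_sub_right]

lemma tendsto_integral_mul {f g : α → ℝ} {gk : ℕ → α → ℝ} (hf : MemLp f 2 μ) (hg : MemLp g 2 μ)
    (hgk : ∀ k, MemLp (gk k) 2 μ)
    (hlim : Tendsto (fun k => eLpNorm (fun x => gk k x - g x) 2 μ) atTop (𝓝 0)) :
    Tendsto (fun k => ∫ x, f x * gk k x ∂μ) atTop (𝓝 (∫ x, f x * g x ∂μ)) := by
  simpa [mul_comm] using tendsto_integral_inner hf hg hgk hlim

lemma memLp_bounded_smul {f : α → E} {η : α → ℝ} (hf : MemLp f 2 μ)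
    (hη : AEStronglyMeasurable η μ) (c : ℝ) (hc : ∀ x, ‖η x‖ ≤ c) :
    MemLp (fun x => η x • f x) 2 μ :=
  hf.of_le_mul (c := c) (hη.smul hf.1) (ae_of_all _ fun x => by
    rw [norm_smul]; exact mul_le_mul_of_nonneg_right (hc x) (norm_nonneg _))

lemma memLp_restrict_of_continuous {F : Type*} [NormedAddCommGroup F]
    {f : Plane → F} (hf : Continuous f) {ν : Measure Plane}
    {s : Set Plane} {ρ : ℝ} (hs : s ⊆ Metric.ball 0 ρ) (hsm : MeasurableSet s) (hν : ν s < ⊤) :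
    MemLp f 2 (ν.restrict s) := by
  obtain ⟨c, hc⟩ :=
    (isCompact_closedBall (0 : Plane) ρ).exists_bound_of_continuousOn hf.continuousOn
  have : IsFiniteMeasure (ν.restrict s) := ⟨by rwa [Measure.restrict_apply_univ]⟩
  refine MemLp.of_bound hf.aestronglyMeasurable c ?_
  filter_upwards [ae_restrict_mem hsm] with p hp using hc p (Metric.ball_subset_closedBall (hs hp))

end Products

/-! ### Gradients and cutoffs -/

lemma continuous_gradient {u : Plane → ℝ} (hu : ContDiff ℝ 1 u) : Continuous (gradient u) :=
  (InnerProductSpace.toDual ℝ Plane).symm.continuous.comp (hu.continuous_fderiv one_ne_zero)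

lemma gradient_mul {u η : Plane → ℝ} (hη : Differentiable ℝ η) (hu : Differentiable ℝ u)
    (p : Plane) :
    gradient (fun q => η q * u q) p = η p • gradient u p + u p • gradient η p := by
  have := (hη p).hasFDerivAt.mul (hu p).hasFDerivAt
  rw [gradient, show fderiv ℝ (fun q => η q * u q) p = _ from this.fderiv, map_add]
  simp [gradient]

lemma gradient_eq_zero_of_notMem_tsupport {η : Plane → ℝ} {p : Plane} (hp : p ∉ tsupport η) :
    gradient η p = 0 := by
  have : fderiv ℝ η p = 0 := by
    by_contra h
    exact hp (support_fderiv_subset ℝ h)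
  rw [gradient, this, map_zero]

/-- A smooth function, equal to `1` in the unit ball and to `0` outside the ball of radius `2`. -/
def unitBump : ContDiffBump (0 : Plane) := ⟨1, 2, one_pos, one_lt_two⟩

/-- The cutoff at the distance `R` from the origin. -/
def cutoff (R : ℝ) (p : Plane) : ℝ := unitBump (R⁻¹ • p)

lemma contDiff_cutoff (R : ℝ) : ContDiff ℝ (⊤ : ℕ∞) (cutoff R) :=
  unitBump.contDiff.comp (contDiff_const_smul _)

lemma cutoff_nonneg (R : ℝ) (p : Plane) : 0 ≤ cutoff R p := unitBump.nonneg

lemma cutoff_le_one (R : ℝ) (p : Plane) : cutoff R p ≤ 1 := unitBump.le_one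

lemma cutoff_eq_one {R : ℝ} (hR : 0 < R) {p : Plane} (hp : ‖p‖ ≤ R) : cutoff R p = 1 := by
  apply unitBump.one_of_mem_closedBall
  rw [mem_closedBall_zero_iff, norm_smul, norm_inv, Real.norm_of_nonneg hR.le]
  rw [show unitBump.rIn = 1 from rfl, inv_mul_le_iff₀ hR]
  simpa using hp

lemma cutoff_eq_zero {R : ℝ} (hR : 0 < R) {p : Plane} (hp : 2 * R ≤ ‖p‖) : cutoff R p = 0 := by
  apply unitBump.zero_of_le_dist
  rw [dist_zero_right, norm_smul, norm_inv, Real.norm_of_nonneg hR.le]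
  rw [show unitBump.rOut = 2 from rfl, le_inv_mul_iff₀ hR]
  linarith

lemma tsupport_cutoff_subset {R : ℝ} (hR : 0 < R) :
    tsupport (cutoff R) ⊆ Metric.closedBall 0 (2 * R) := by
  refine closure_minimal (fun p hp => ?_) Metric.isClosed_closedBall
  rw [mem_closedBall_zero_iff]
  by_contra h
  exact hp (cutoff_eq_zero hR (not_le.1 h).le)

lemma gradient_cutoff_eq_zero {R : ℝ} (hR : 0 < R) {p : Plane} (hp : ¬(R ≤ ‖p‖ ∧ ‖p‖ ≤ 2 * R)) :
    gradient (cutoff R) p = 0 := by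
  rcases not_and_or.1 hp with h | h
  · have : cutoff R =ᶠ[𝓝 p] fun _ => 1 := by
      filter_upwards [(isOpen_lt continuous_norm continuous_const).mem_nhds (not_le.1 h)] with q hq
      exact cutoff_eq_one hR (le_of_lt hq)
    rw [this.gradient_eq, gradient_fun_const]
  · refine gradient_eq_zero_of_notMem_tsupport fun hmem => h ?_
    simpa using tsupport_cutoff_subset hR hmem

/-- The decay `R⁻¹` comes from scaling and will balance the growth of `φ` in annuli. -/
lemma exists_norm_gradient_cutoff_le :
    ∃ M : NNReal, ∀ R : ℝ, 0 < R → ∀ p, ‖gradient (cutoff R) p‖ ≤ M * R⁻¹ := by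
  obtain ⟨M, hM⟩ := (unitBump.contDiff (n := 1)).lipschitzWith_of_hasCompactSupport
    unitBump.hasCompactSupport one_ne_zero
  refine ⟨M, fun R hR p => ?_⟩
  have hlip : LipschitzWith (M * ⟨R⁻¹, (inv_pos.2 hR).le⟩) (cutoff R) := by
    refine hM.comp (LipschitzWith.of_dist_le_mul fun x y => ?_)
    rw [dist_smul₀, Real.norm_of_nonneg (inv_pos.2 hR).le]
    rfl
  have := norm_fderiv_le_of_lipschitz ℝ hlip (x₀ := p)
  rw [gradient, LinearIsometryEquiv.norm_map]
  exact this

namespace FloatingSystem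

variable {C : FloatingSystem}

/-! ### The energy identity -/

lemma wetted_subset_closure_body : C.wetted ⊆ closure C.body :=
  inter_subset_left.trans frontier_subset_closure

lemma IsAdmissible.exists_wetted_subset (hC : C.IsAdmissible) :
    ∃ R > 0, (∀ p ∈ C.wetted, ‖p‖ ≤ R) ∧ C.wetted ⊆ frontier C.water ∩ Metric.ball 0 (R + 1) := by
  obtain ⟨R, hR0, hR⟩ := hC.exists_body_subset
  have h : ∀ p ∈ C.wetted, ‖p‖ ≤ R := fun p hp =>
    mem_closedBall_zero_iff.1 (hR (wetted_subset_closure_body hp))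
  exact ⟨R, hR0, h, fun p hp => ⟨hC.wetted_subset hp,
    mem_ball_zero_iff.2 (by linarith [h p hp])⟩⟩

lemma IsAdmissible.arcLength_wetted_lt_top (hC : C.IsAdmissible) : arcLength C.wetted < ⊤ := by
  obtain ⟨R, -, -, hR⟩ := hC.exists_wetted_subset
  exact (measure_mono hR).trans_lt
    (hC.water_lipschitz.lipschitz.arcLength_frontier_lt_top (R + 1))

lemma IsAdmissible.memLp_normalN (hC : C.IsAdmissible) (j : Fin 3) :
    MemLp (fun p => C.normalN p j) 2 (arcLength.restrict C.wetted) := by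
  obtain ⟨R, hR0, hpR', hR⟩ := hC.exists_wetted_subset
  have : IsFiniteMeasure (arcLength.restrict C.wetted) :=
    ⟨by rw [Measure.restrict_apply_univ]; exact hC.arcLength_wetted_lt_top⟩
  have hn : AEMeasurable (exteriorNormal C.water) (arcLength.restrict C.wetted) := by
    exact (hC.water_lipschitz.lipschitz.aemeasurable_exteriorNormal (R + 1)).mono_measure
      (Measure.restrict_mono hR le_rfl)
  have hni : ∀ i, AEMeasurable (fun p => exteriorNormal C.water p i)
      (arcLength.restrict C.wetted) := fun i =>
    (by fun_prop : Measurable fun q : Plane => q i).comp_aemeasurable hn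
  have hi : ∀ (p : Plane) i, |p i| ≤ ‖p‖ := fun p i => by simpa using PiLp.norm_apply_le p i
  have hb : ∀ p i, |exteriorNormal C.water p i| ≤ 1 := fun p i =>
    (hi _ i).trans (norm_exteriorNormal_le _ _)
  have hmeas : AEStronglyMeasurable (fun p => C.normalN p j) (arcLength.restrict C.wetted) := by
    have h0 := hni 0
    have h1 := hni 1
    apply AEMeasurable.aestronglyMeasurable
    fin_cases j
    · exact h0
    · exact h1
    · change AEMeasurable (fun p => (p 0 - C.x₀) * exteriorNormal C.water p 1 -
        (p 1 - C.y₀) * exteriorNormal C.water p 0) _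
      exact ((by fun_prop : Measurable fun p : Plane => p 0 - C.x₀).aemeasurable.mul h1).sub
        ((by fun_prop : Measurable fun p : Plane => p 1 - C.y₀).aemeasurable.mul h0)
  refine MemLp.of_bound hmeas (1 + (R + |C.x₀|) + (R + |C.y₀|)) ?_
  filter_upwards [ae_restrict_mem measurableSet_wetted] with p hp
  have hpR := hpR' p hp
  have a0 : |p 0 - C.x₀| ≤ R + |C.x₀| := (abs_sub _ _).trans (by linarith [hi p 0])
  have a1 : |p 1 - C.y₀| ≤ R + |C.y₀| := (abs_sub _ _).trans (by linarith [hi p 1])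
  have n0 := hb p 0
  have n1 := hb p 1
  rw [Real.norm_eq_abs]
  have p0 := abs_nonneg C.x₀
  have p1 := abs_nonneg C.y₀
  fin_cases j
  · exact n0.trans (by linarith)
  · exact n1.trans (by linarith)
  · change |(p 0 - C.x₀) * exteriorNormal C.water p 1 -
        (p 1 - C.y₀) * exteriorNormal C.water p 0| ≤ _
    refine (abs_sub _ _).trans ?_
    rw [abs_mul, abs_mul]
    have m0 := mul_le_mul a0 n1 (abs_nonneg _) (by linarith)
    have m1 := mul_le_mul a1 n0 (abs_nonneg _) (by linarith)
    linarith

lemma IsAdmissible.memLp_normalN_dotProduct (hC : C.IsAdmissible) (χ : Fin 3 → ℝ) :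
    MemLp (fun p => C.normalN p ⬝ᵥ χ) 2 (arcLength.restrict C.wetted) := by
  simp only [dotProduct]
  exact memLp_finsetSum _ fun j _ => (hC.memLp_normalN j).mul_const (χ j)

lemma MemEnergySpace.memLp_trace_wetted (hC : C.IsAdmissible) {φ : Plane → ℝ} {G : Plane → Plane}
    {t : Plane → ℝ} (h : C.MemEnergySpace φ G t) : MemLp t 2 (arcLength.restrict C.wetted) := by
  obtain ⟨R, -, -, hR⟩ := hC.exists_wetted_subset
  exact (h.trace.memLp (R + 1)).mono_measure (Measure.restrict_mono hR le_rfl)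

/-- The integral identity tested with the product of the solution and a cutoff. -/
lemma MemEnergySpace.localized_energy_identity (hC : C.IsAdmissible) {φ : Plane → ℝ}
    {G : Plane → Plane} {t : Plane → ℝ} (h : C.MemEnergySpace φ G t) {ω : ℝ} {χ : Fin 3 → ℝ}
    (hsol : C.SolvesIntegralIdentity ω G t χ) {η : Plane → ℝ} (hη : ContDiff ℝ (⊤ : ℕ∞) η) {ρ : ℝ}
    (hηρ : tsupport η ⊆ Metric.ball 0 ρ) (hη1 : ∀ p ∈ C.wetted, η p = 1) :
    (∫ p in C.water, ⟪η p • G p, G p⟫_ℝ) + (∫ p in C.water, ⟪G p, gradient η p⟫_ℝ * φ p) =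
      C.nu ω * (∫ p in C.freeSurface, η p * t p * t p ∂arcLength) +
        ω * ∫ p in C.wetted, (C.normalN p ⬝ᵥ χ) * t p ∂arcLength := by
  obtain ⟨u, hu, hlim⟩ := h.trace.approx
  obtain ⟨l1, l2, l3⟩ := hlim ρ
  have hη' : ContDiff ℝ 1 η := hη.of_le (by simp)
  have hu' : ∀ k, ContDiff ℝ 1 (u k) := fun k => (hu k).of_le (by simp)
  have hcs : HasCompactSupport η :=
    HasCompactSupport.of_support_subset_isCompact (isCompact_closedBall 0 ρ)
      ((subset_tsupport _).trans (hηρ.trans Metric.ball_subset_closedBall))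
  have hη0 : ∀ p ∉ Metric.ball 0 ρ, η p = 0 := fun p hp => by
    by_contra h0
    exact hp (hηρ (subset_tsupport _ h0))
  have hg0 : ∀ p ∉ Metric.ball 0 ρ, gradient η p = 0 := fun p hp =>
    gradient_eq_zero_of_notMem_tsupport fun h0 => hp (hηρ h0)
  obtain ⟨c, hc⟩ := hη'.continuous.bounded_above_of_compact_support hcs
  obtain ⟨c', hc'⟩ := hη'.lipschitzWith_of_hasCompactSupport hcs one_ne_zero
  have hc'' : ∀ p, ‖gradient η p‖ ≤ c' := fun p => by
    rw [gradient, LinearIsometryEquiv.norm_map]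
    exact norm_fderiv_le_of_lipschitz ℝ hc'
  have hηm : ∀ ν : Measure Plane, AEStronglyMeasurable η ν := fun ν =>
    hη'.continuous.aestronglyMeasurable
  have hWm := hC.measurableSet_water
  set μ := volume.restrict (C.water ∩ Metric.ball 0 ρ) with hμ
  set σ := arcLength.restrict (frontier C.water ∩ Metric.ball 0 ρ) with hσ
  have hFσ : arcLength.restrict (C.freeSurface ∩ Metric.ball 0 ρ) ≤ σ :=
    Measure.restrict_mono (inter_subset_inter_left _ hC.freeSurface_subset) le_rfl
  -- The cutoff equals `1` on `S` and vanishes outside the ball, so `S` lies in the ball.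
  have hSσ : arcLength.restrict C.wetted ≤ σ := by
    refine Measure.restrict_mono (subset_inter hC.wetted_subset fun p hp => ?_) le_rfl
    by_contra h0
    exact one_ne_zero ((hη1 p hp).symm.trans (hη0 p h0))
  have gφ : MemLp φ 2 μ := h.loc.memLp _
  have gG : MemLp G 2 μ := h.loc.memLp_grad _
  have gt : MemLp t 2 σ := h.trace.memLp _
  have gu : ∀ k, MemLp (u k) 2 μ := fun k =>
    memLp_restrict_of_continuous (hu' k).continuous inter_subset_right
      (hWm.inter Metric.isOpen_ball.measurableSet)
      ((measure_mono inter_subset_right).trans_lt measure_ball_lt_top)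
  have gdu : ∀ k, MemLp (gradient (u k)) 2 μ := fun k =>
    memLp_restrict_of_continuous (continuous_gradient (hu' k)) inter_subset_right
      (hWm.inter Metric.isOpen_ball.measurableSet)
      ((measure_mono inter_subset_right).trans_lt measure_ball_lt_top)
  have guσ : ∀ k, MemLp (u k) 2 σ := fun k =>
    memLp_restrict_of_continuous (hu' k).continuous inter_subset_right
      (isClosed_frontier.measurableSet.inter Metric.isOpen_ball.measurableSet)
      (hC.water_lipschitz.lipschitz.arcLength_frontier_lt_top ρ)
  have gηG : MemLp (fun p => η p • G p) 2 μ := memLp_bounded_smul gG (hηm _) c hc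
  have gGη : MemLp (fun p => ⟪G p, gradient η p⟫_ℝ) 2 μ :=
    gG.of_le_mul (c := c') (gG.1.inner (continuous_gradient hη').aestronglyMeasurable)
      (ae_of_all _ fun p => (norm_inner_le_norm _ _).trans (by
        rw [mul_comm]; exact mul_le_mul_of_nonneg_right (hc'' p) (norm_nonneg _)))
  have gηt : MemLp (fun p => η p * t p) 2 (arcLength.restrict (C.freeSurface ∩ Metric.ball 0 ρ)) :=
    memLp_bounded_smul (gt.mono_measure hFσ) (hηm _) c hc
  have iGη : ∀ k, Integrable (fun p => ⟪G p, gradient η p⟫_ℝ * u k p) μ := fun k =>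
    gGη.integrable_mul (gu k)
  have redW : ∀ F : Plane → ℝ, (∀ p ∉ Metric.ball 0 ρ, F p = 0) →
      ∫ p in C.water, F p = ∫ p, F p ∂μ := fun F hF =>
    setIntegral_eq_of_subset_of_forall_sdiff_eq_zero hWm inter_subset_left
      fun p hp => hF p fun hb => hp.2 ⟨hp.1, hb⟩
  have redF : ∀ F : Plane → ℝ, (∀ p ∉ Metric.ball 0 ρ, F p = 0) →
      ∫ p in C.freeSurface, F p ∂arcLength =
        ∫ p in C.freeSurface ∩ Metric.ball 0 ρ, F p ∂arcLength := fun F hF =>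
    setIntegral_eq_of_subset_of_forall_sdiff_eq_zero measurableSet_freeSurface inter_subset_left
      fun p hp => hF p fun hb => hp.2 ⟨hp.1, hb⟩
  -- Only smooth functions may be tested, hence `η u k` in place of `η φ`. The approximants converge
  -- simultaneously in `H¹` and on the boundary, so every term passes to the limit.
  have hid : ∀ k, (∫ p, ⟪η p • G p, gradient (u k) p⟫_ℝ ∂μ) +
      (∫ p, ⟪G p, gradient η p⟫_ℝ * u k p ∂μ) =
      C.nu ω * (∫ p in C.freeSurface ∩ Metric.ball 0 ρ, η p * t p * u k p ∂arcLength) +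
        ω * ∫ p in C.wetted, (C.normalN p ⬝ᵥ χ) * u k p ∂arcLength := by
    intro k
    have hk := hsol (fun p => η p * u k p) (hη.mul (hu k)) hcs.mul_right
    have hgr : ∀ p, ⟪G p, gradient (fun q => η q * u k q) p⟫_ℝ =
        ⟪η p • G p, gradient (u k) p⟫_ℝ + ⟪G p, gradient η p⟫_ℝ * u k p := by
      intro p
      rw [gradient_mul (hη'.differentiable one_ne_zero) ((hu' k).differentiable one_ne_zero),
        inner_add_right, inner_smul_right, inner_smul_right, inner_smul_left]
      simp [mul_comm]
    simp_rw [hgr] at hk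
    rw [redW _ (fun p hp => by simp [hη0 p hp, hg0 p hp]),
      redF _ (fun p hp => by simp [hη0 p hp]),
      integral_add (integrable_inner_of_memLp gηG (gdu k)) (iGη k)] at hk
    rw [hk]
    congr 2
    · exact integral_congr_ae (ae_of_all _ fun p => by ring)
    · refine setIntegral_congr_fun measurableSet_wetted fun p hp => ?_
      simp only [hη1 p hp]
      ring
  have L1 := tendsto_integral_inner gηG gG gdu l2
  have L2 := tendsto_integral_mul gGη gφ gu l1
  have tmono : ∀ {ν : Measure Plane}, ν ≤ σ →
      Tendsto (fun k => eLpNorm (fun p => u k p - t p) 2 ν) atTop (𝓝 0) := fun hν =>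
    tendsto_of_tendsto_of_tendsto_of_le_of_le tendsto_const_nhds l3 (fun _ => zero_le)
      fun k => eLpNorm_mono_measure _ hν
  have L3 := tendsto_integral_mul gηt (gt.mono_measure hFσ)
    (fun k => (guσ k).mono_measure hFσ) (tmono hFσ)
  have L4 := tendsto_integral_mul (hC.memLp_normalN_dotProduct χ) (gt.mono_measure hSσ)
    (fun k => (guσ k).mono_measure hSσ) (tmono hSσ)
  have hL := L1.add L2
  simp_rw [hid] at hL
  have := tendsto_nhds_unique hL ((L3.const_mul (C.nu ω)).add (L4.const_mul ω))
  rw [redW _ (fun p hp => by simp [hη0 p hp]), redW _ (fun p hp => by simp [hg0 p hp]),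
    redF _ (fun p hp => by simp [hη0 p hp]), this]

end FloatingSystem

/-! ### Removal of the cutoff -/

lemma tendsto_eLpNorm_outside_ball {E : Type*} [NormedAddCommGroup E] {G : Plane → E}
    {W : Set Plane} (hG : MemLp G 2 (volume.restrict W)) :
    Tendsto (fun n : ℕ => eLpNorm G 2 (volume.restrict (W ∩ {p | (n : ℝ) ≤ ‖p‖})))
      atTop (𝓝 0) := by
  set s : ℕ → Set Plane := fun n => {p | (n : ℝ) ≤ ‖p‖} with hs
  have hsm : ∀ n, MeasurableSet (s n) := fun n => measurableSet_le measurable_const measurable_norm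
  set ν := (volume.restrict W).withDensity fun p => ‖G p‖ₑ ^ 2 with hν
  have hνs : ∀ n, ν (s n) = eLpNorm G 2 (volume.restrict (W ∩ s n)) ^ 2 := fun n => by
    rw [hν, withDensity_apply _ (hsm n), Measure.restrict_restrict (hsm n), inter_comm,
      FloatingSystem.eLpNorm_two_sq]
  have hfin : ν (s 0) ≠ ⊤ := by
    rw [hνs]
    exact ENNReal.pow_ne_top ((eLpNorm_mono_measure _
      (Measure.restrict_mono inter_subset_left le_rfl)).trans_lt hG.2).ne
  have hanti : Antitone s := fun m n hmn p (hp : (n : ℝ) ≤ ‖p‖) =>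
    (Nat.cast_le.2 hmn).trans hp
  have hempty : ⋂ n, s n = ∅ := by
    rw [eq_empty_iff_forall_notMem]
    intro p hp
    obtain ⟨n, hn⟩ := exists_nat_gt ‖p‖
    exact absurd (mem_iInter.1 hp n) (not_le.2 hn)
  have h := tendsto_measure_iInter_atTop (μ := ν) (fun n => (hsm n).nullMeasurableSet) hanti
    ⟨0, hfin⟩
  rw [hempty, measure_empty] at h
  have h2 := (ENNReal.continuous_rpow_const (y := (1 / 2 : ℝ))).tendsto 0 |>.comp h
  rw [ENNReal.zero_rpow_of_pos (by norm_num)] at h2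
  refine h2.congr fun n => ?_
  simp only [Function.comp_apply]
  rw [hνs, ← ENNReal.rpow_natCast, ← ENNReal.rpow_mul]
  norm_num [hs]

lemma eventually_cutoff_eq_one (p : Plane) : ∀ᶠ n : ℕ in atTop, cutoff n p = 1 := by
  filter_upwards [eventually_ge_atTop ⌈‖p‖⌉₊, eventually_gt_atTop 0] with n hn hn0
  exact cutoff_eq_one (Nat.cast_pos.2 hn0) (Nat.ceil_le.1 hn)

lemma tendsto_integral_cutoff_mul {ν : Measure Plane} {F : Plane → ℝ} (hF : Integrable F ν) :
    Tendsto (fun n : ℕ => ∫ p, cutoff n p * F p ∂ν) atTop (𝓝 (∫ p, F p ∂ν)) := by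
  refine tendsto_integral_of_dominated_convergence (fun p => ‖F p‖)
    (fun n => (contDiff_cutoff n).continuous.aestronglyMeasurable.mul hF.1) hF.norm
    (fun n => ae_of_all _ fun p => ?_) (ae_of_all _ fun p => ?_)
  · rw [norm_mul, Real.norm_of_nonneg (cutoff_nonneg _ _)]
    exact mul_le_of_le_one_left (norm_nonneg _) (cutoff_le_one _ _)
  · refine tendsto_const_nhds.congr' ?_
    filter_upwards [eventually_cutoff_eq_one p] with n hn
    rw [hn, one_mul]

namespace FloatingSystem

variable {C : FloatingSystem} {φ : Plane → ℝ} {G : Plane → Plane} {t : Plane → ℝ}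

/-- In the annulus the gradient of the cutoff is at most `M / n` and the norm of `φ` at most `20 n
m`, so their product stays bounded; the convergence to zero comes from the tail of the Dirichlet
integral. -/
lemma MemEnergySpace.tendsto_cutoff_error (hC : C.IsAdmissible) (h : C.MemEnergySpace φ G t) :
    Tendsto (fun n : ℕ => ∫ p in C.water, ⟪G p, gradient (cutoff n) p⟫_ℝ * φ p) atTop (𝓝 0) := by
  obtain ⟨R₀, hR0, hR₀⟩ := hC.exists_body_subset
  obtain ⟨M, hM⟩ := exists_norm_gradient_cutoff_le
  set m := eLpNorm t 2 (arcLength.restrict C.freeSurface) + eLpNorm G 2 (volume.restrict C.water)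
    with hm
  have hmfin : m ≠ ⊤ := ENNReal.add_ne_top.2 ⟨h.trace_memLp.2.ne, h.grad_memLp.2.ne⟩
  have hlim : Tendsto (fun n : ℕ => ENNReal.ofReal (20 * M) * m *
      eLpNorm G 2 (volume.restrict (C.water ∩ {p | (n : ℝ) ≤ ‖p‖}))) atTop (𝓝 0) := by
    have := ENNReal.Tendsto.const_mul (a := ENNReal.ofReal (20 * M) * m)
      (tendsto_eLpNorm_outside_ball h.grad_memLp)
      (Or.inr (ENNReal.mul_ne_top ENNReal.ofReal_ne_top hmfin))
    rwa [mul_zero] at this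
  rw [tendsto_zero_iff_enorm_tendsto_zero]
  refine tendsto_of_tendsto_of_tendsto_of_le_of_le' tendsto_const_nhds hlim
    (Eventually.of_forall fun _ => zero_le) ?_
  filter_upwards [eventually_ge_atTop ⌈4 * R₀⌉₊, eventually_ge_atTop 1] with n hn hn1
  have hnR : 4 * R₀ ≤ n := Nat.ceil_le.1 hn
  have hn1' : (1 : ℝ) ≤ n := by exact_mod_cast hn1
  have hn0 : (0 : ℝ) < n := by linarith
  have hφm : AEStronglyMeasurable φ (volume.restrict (C.waterAnnulus n)) := by
    refine (h.loc.memLp (3 * n)).1.mono_measure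
      (Measure.restrict_mono (inter_subset_inter_right _ fun p hp => ?_) le_rfl)
    rw [mem_ball_zero_iff]
    linarith [hp.2]
  have hGm : AEStronglyMeasurable G (volume.restrict (C.waterAnnulus n)) :=
    h.grad_memLp.1.mono_measure (Measure.restrict_mono inter_subset_left le_rfl)
  have hgc : Continuous (gradient (cutoff n)) :=
    continuous_gradient ((contDiff_cutoff n).of_le (by simp))
  rw [setIntegral_eq_of_subset_of_forall_sdiff_eq_zero (s := C.waterAnnulus n)
    hC.measurableSet_water inter_subset_left (fun p hp => by
      rw [gradient_cutoff_eq_zero hn0 fun hh => hp.2 ⟨hp.1, hh⟩]; simp)]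
  have e1 : ‖∫ p in C.waterAnnulus n, ⟪G p, gradient (cutoff n) p⟫_ℝ * φ p‖ₑ ≤
      eLpNorm (fun p => ⟪G p, φ p • gradient (cutoff n) p⟫_ℝ) 1
        (volume.restrict (C.waterAnnulus n)) := by
    rw [eLpNorm_one_eq_lintegral_enorm]
    refine (enorm_integral_le_lintegral_enorm _).trans (le_of_eq ?_)
    refine lintegral_congr fun p => ?_
    rw [inner_smul_right, mul_comm]
  have e2 : eLpNorm (fun p => φ p • gradient (cutoff n) p) 2
      (volume.restrict (C.waterAnnulus n)) ≤ ENNReal.ofReal (M * (n : ℝ)⁻¹) *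
        eLpNorm φ 2 (volume.restrict (C.waterAnnulus n)) := by
    refine eLpNorm_le_mul_eLpNorm_of_ae_le_mul (ae_of_all _ fun p => ?_) 2
    rw [norm_smul, mul_comm]
    exact mul_le_mul_of_nonneg_right (hM n hn0 p) (norm_nonneg _)
  have e3 := h.eLpNorm_waterAnnulus_le hC hR₀ hnR hn1'
  refine e1.trans ((eLpNorm_inner_le hGm (hφm.smul hgc.aestronglyMeasurable)).trans ?_)
  rw [mul_comm]
  refine mul_le_mul' (e2.trans ?_) (eLpNorm_mono_measure _
    (Measure.restrict_mono (inter_subset_inter_right _ fun p hp => hp.1) le_rfl))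
  refine (mul_le_mul_right e3 _).trans (le_of_eq ?_)
  rw [← mul_assoc, ← ENNReal.ofReal_mul (by positivity)]
  congr 2
  field_simp

/-- The integral identity tested with the solution itself. -/
theorem MemEnergySpace.energy_identity (hC : C.IsAdmissible) (h : C.MemEnergySpace φ G t) {ω : ℝ}
    {χ : Fin 3 → ℝ} (hsol : C.SolvesIntegralIdentity ω G t χ) :
    ∫ p in C.water, ‖G p‖ ^ 2 = C.nu ω * (∫ p in C.freeSurface, t p ^ 2 ∂arcLength) +
      ω * ∫ p in C.wetted, (C.normalN p ⬝ᵥ χ) * t p ∂arcLength := by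
  obtain ⟨R, hR0, hR, -⟩ := hC.exists_wetted_subset
  have iG : Integrable (fun p => ‖G p‖ ^ 2) (volume.restrict C.water) :=
    h.grad_memLp.integrable_norm_pow (p := 2) two_ne_zero
  have it : Integrable (fun p => t p ^ 2) (arcLength.restrict C.freeSurface) :=
    h.trace_memLp.integrable_sq
  have L := (tendsto_integral_cutoff_mul iG).add (h.tendsto_cutoff_error hC)
  have L' := ((tendsto_integral_cutoff_mul it).const_mul (C.nu ω)).add_const
    (ω * ∫ p in C.wetted, (C.normalN p ⬝ᵥ χ) * t p ∂arcLength)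
  rw [add_zero] at L
  refine tendsto_nhds_unique L (L'.congr' ?_)
  filter_upwards [eventually_ge_atTop ⌈R⌉₊, eventually_gt_atTop 0] with n hn hn0
  have hn0' : (0 : ℝ) < n := Nat.cast_pos.2 hn0
  have := h.localized_energy_identity hC hsol (contDiff_cutoff n) (ρ := 3 * n)
    ((tsupport_cutoff_subset hn0').trans (Metric.closedBall_subset_ball (by linarith)))
    (fun p hp => cutoff_eq_one hn0' ((hR p hp).trans (Nat.ceil_le.1 hn)))
  simp only [inner_smul_left, real_inner_self_eq_norm_sq, conj_trivial, mul_assoc, ← pow_two]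
    at this
  exact this.symm

end FloatingSystem

/-! ### Rigid velocity fields -/

/-- The velocity field `(c₁ - k y, c₂ + k x)` of a rigid motion. -/
def rigidField (c₁ c₂ k : ℝ) (p : Plane) : Plane := !₂[c₁ - k * p 1, c₂ + k * p 0]

section RigidField

variable (c₁ c₂ k : ℝ)

lemma inner_plane (u v : Plane) : ⟪u, v⟫_ℝ = u 0 * v 0 + u 1 * v 1 := by
  simp [PiLp.inner_apply, Fin.sum_univ_two, mul_comm]

lemma frame_apply (e : OrthonormalBasis (Fin 2) ℝ Plane) (z : ℝ × ℝ) (i : Fin 2) :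
    frame e z i = z.1 * e 0 i + z.2 * e 1 i := by
  simp [frame]

lemma continuous_rigidField : Continuous (rigidField c₁ c₂ k) := by
  unfold rigidField; fun_prop

/-- A rigid field keeps its form in every Cartesian frame; the angular velocity is multiplied by the
determinant of the frame, since charts of either orientation occur. -/
lemma rigidField_frame (e : OrthonormalBasis (Fin 2) ℝ Plane) (z : ℝ × ℝ) :
    rigidField c₁ c₂ k (frame e z) = frame e
      (e 0 0 * c₁ + e 0 1 * c₂ - k * (e 0 0 * e 1 1 - e 0 1 * e 1 0) * z.2,
        e 1 0 * c₁ + e 1 1 * c₂ + k * (e 0 0 * e 1 1 - e 0 1 * e 1 0) * z.1) := by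
  conv_lhs => rw [← frame_inner e (rigidField c₁ c₂ k (frame e z))]
  congr 1
  rw [inner_plane, inner_plane]
  simp only [rigidField, frame_apply, PiLp.toLp_apply, cons_val_zero, cons_val_one]
  ext <;> simp only <;> ring

lemma continuous_fderiv_rigidField {θ : Plane → ℝ} (hθ : ContDiff ℝ 1 θ) :
    Continuous fun p => fderiv ℝ θ p (rigidField c₁ c₂ k p) :=
  (hθ.continuous_fderiv one_ne_zero).clm_apply (continuous_rigidField c₁ c₂ k)

lemma fderiv_rigidField_eq_zero {θ : Plane → ℝ} {p : Plane} (hp : p ∉ tsupport θ) :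
    fderiv ℝ θ p (rigidField c₁ c₂ k p) = 0 := by
  have : fderiv ℝ θ p = 0 := by
    by_contra h
    exact hp (support_fderiv_subset ℝ h)
  rw [this]; rfl

lemma integrable_fderiv_rigidField {θ : Plane → ℝ} (hθ : ContDiff ℝ 1 θ)
    (hs : HasCompactSupport θ) :
    Integrable fun p => fderiv ℝ θ p (rigidField c₁ c₂ k p) :=
  (continuous_fderiv_rigidField c₁ c₂ k hθ).integrable_of_hasCompactSupport
    (HasCompactSupport.of_support_subset_isCompact hs fun p hp => by
      by_contra h
      exact hp (fderiv_rigidField_eq_zero c₁ c₂ k h))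

variable {c₁ c₂ k}

/-- The flux of a rigid field through a Lipschitz graph, to which it is tangent, vanishes. -/
lemma integral_fderiv_rigidField_above_graph {B : Set Plane} {p : Plane}
    {e : OrthonormalBasis (Fin 2) ℝ Plane} {f : ℝ → ℝ} {L : NNReal} {r : ℝ}
    (hf : LipschitzWith L f) (hBm : MeasurableSet B)
    (hB : ∀ q ∈ Metric.ball p r, q ∈ B ↔ f ⟪e 0, q⟫_ℝ < ⟪e 1, q⟫_ℝ)
    (ht : ∀ᵐ x, graphMap e f x ∈ Metric.ball p r →
      ⟪frame e (-deriv f x, 1), rigidField c₁ c₂ k (graphMap e f x)⟫_ℝ = 0)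
    {θ : Plane → ℝ} (hθ : ContDiff ℝ 1 θ) (hs : HasCompactSupport θ)
    (hθs : tsupport θ ⊆ Metric.ball p r) :
    ∫ q in B, fderiv ℝ θ q (rigidField c₁ c₂ k q) = 0 := by
  have hfc := hf.continuous
  set A : Set Plane := {q | f ⟪e 0, q⟫_ℝ < ⟪e 1, q⟫_ℝ} with hA
  have hAm : MeasurableSet A := (isOpen_lt (by fun_prop) (by fun_prop)).measurableSet
  have h1 : ∫ q in B, fderiv ℝ θ q (rigidField c₁ c₂ k q) =
      ∫ q in A, fderiv ℝ θ q (rigidField c₁ c₂ k q) := by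
    rw [← integral_indicator hBm, ← integral_indicator hAm]
    congr 1
    ext q
    by_cases hq : q ∈ Metric.ball p r
    · simp only [indicator, hB q hq, hA, mem_ofPred_eq]
    · have := fderiv_rigidField_eq_zero c₁ c₂ k fun h => hq (hθs h)
      simp [indicator, this]
  have hpre : frame e ⁻¹' A = {z : ℝ × ℝ | f z.1 < z.2} := by
    ext z
    simp [hA, inner_frame_zero, inner_frame_one]
  rw [h1, ← (measurePreserving_frame e).setIntegral_preimage_emb (measurableEmbedding_frame e),
    hpre]
  have hg : ContDiff ℝ 1 fun z => θ (frame e z) := hθ.comp (contDiff_frame e)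
  have hgs : HasCompactSupport fun z => θ (frame e z) := hs.comp_homeomorph (frameHomeomorph e)
  refine Eq.trans (integral_congr_ae (ae_of_all _ fun z => ?_))
    (integral_above_graph_rigid_field hf hg hgs (e 0 0 * c₁ + e 0 1 * c₂)
      (e 1 0 * c₁ + e 1 1 * c₂) (k * (e 0 0 * e 1 1 - e 0 1 * e 1 0)) ?_)
  · simp only
    rw [fderiv_comp_frame e (hθ.differentiable one_ne_zero), inner_gradient_left, rigidField_frame]
  · filter_upwards [ht] with x hx h0
    have := hx (hθs (subset_tsupport _ h0))
    rw [graphMap, rigidField_frame, inner_frame_frame] at this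
    simp only at this
    linarith

/-- The interior case is a degenerate graph case: the horizontal line at the lowest level of the
ball misses the open ball, so tangency is required nowhere. -/
lemma integral_fderiv_rigidField_of_tsupport_subset {B : Set Plane} (hBm : MeasurableSet B)
    {θ : Plane → ℝ} (hθ : ContDiff ℝ 1 θ) (hs : HasCompactSupport θ) {p : Plane} {r : ℝ}
    (hθs : tsupport θ ⊆ Metric.ball p r) (hB : Metric.ball p r ⊆ B) :
    ∫ q in B, fderiv ℝ θ q (rigidField c₁ c₂ k q) = 0 := by
  have hball : ∀ q ∈ Metric.ball p r, p 1 - r < q 1 := fun q hq => by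
    have h1 : |q 1 - p 1| ≤ ‖q - p‖ := by simpa using PiLp.norm_apply_le (q - p) 1
    rw [Metric.mem_ball, dist_eq_norm] at hq
    linarith [neg_abs_le (q 1 - p 1)]
  refine integral_fderiv_rigidField_above_graph (e := stdBasis) (p := p) (r := r)
    (LipschitzWith.const (p 1 - r)) hBm (fun q hq => ?_) (ae_of_all _ fun x hx => ?_) hθ hs hθs
  · rw [inner_stdBasis]
    exact iff_of_true (hB hq) (hball q hq)
  · have := hball _ hx
    rw [graphMap, frame_stdBasis_one] at this
    exact absurd this (lt_irrefl _)

open scoped Manifold ContDiff in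
/-- A smooth function that is compactly supported can be split, in an open set `B`, into smooth
functions supported in prescribed neighbourhoods of the points of the closure of `B`. -/
lemma exists_smooth_splitting {B : Set Plane} {θ : Plane → ℝ}
    (hθ : ContDiff ℝ ∞ θ) (hs : HasCompactSupport θ) (U : Plane → Set Plane)
    (hU : ∀ p, IsOpen (U p)) (hpU : ∀ p ∈ tsupport θ ∩ closure B, p ∈ U p) :
    ∃ (t : Finset Plane) (ζ : t → Plane → ℝ), (∀ i : t, (i : Plane) ∈ tsupport θ ∩ closure B) ∧
      (∀ i, ContDiff ℝ 1 (ζ i) ∧ HasCompactSupport (ζ i) ∧ tsupport (ζ i) ⊆ U i) ∧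
      ∀ q ∈ B, θ q = ∑ i, ζ i q := by
  set K := tsupport θ ∩ closure B with hK
  have hKc : IsCompact K := hs.inter_right isClosed_closure
  obtain ⟨t, ht, htc⟩ := hKc.elim_nhds_subcover U fun p hp => (hU p).mem_nhds (hpU p hp)
  obtain ⟨ρ, hρ⟩ := SmoothPartitionOfUnity.exists_isSubordinate 𝓘(ℝ, Plane) hKc.isClosed
    (fun i : t => U i) (fun i => hU i) (fun q hq => by
      obtain ⟨p, hp, hqp⟩ := mem_iUnion₂.1 (htc hq)
      exact mem_iUnion.2 ⟨⟨p, hp⟩, hqp⟩)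
  refine ⟨t, fun i q => ρ i q * θ q, fun i => ht i i.2, fun i => ⟨?_, hs.mul_left, ?_⟩,
    fun q hq => ?_⟩
  · exact ((ρ i).contMDiff.contDiff.mul hθ).of_le (by simp)
  · exact (closure_mono (Function.support_mul_subset_left _ _)).trans (hρ i)
  · rw [← Finset.sum_mul]
    -- The partition sums to one on `tsupport θ ∩ closure B`; at the other points of `B` both sides
    -- vanish with `θ`.
    by_cases hqs : q ∈ tsupport θ
    · have := ρ.sum_eq_one (x := q) ⟨hqs, subset_closure hq⟩
      rw [finsum_eq_sum_of_fintype] at this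
      rw [this, one_mul]
    · rw [image_eq_zero_of_notMem_tsupport hqs, mul_zero]

/-- If the flux of a rigid field vanishes locally, it vanishes. -/
lemma integral_fderiv_rigidField_of_local {B : Set Plane} (hB : IsOpen B) {θ : Plane → ℝ}
    (hθ : ContDiff ℝ (⊤ : ℕ∞) θ) (hs : HasCompactSupport θ)
    (hloc : ∀ p ∈ tsupport θ ∩ closure B, ∃ r > 0, ∀ ζ : Plane → ℝ, ContDiff ℝ 1 ζ →
      HasCompactSupport ζ → tsupport ζ ⊆ Metric.ball p r →
        ∫ q in B, fderiv ℝ ζ q (rigidField c₁ c₂ k q) = 0) :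
    ∫ q in B, fderiv ℝ θ q (rigidField c₁ c₂ k q) = 0 := by
  have : ∀ p, ∃ r : ℝ, p ∈ tsupport θ ∩ closure B → 0 < r ∧ ∀ ζ : Plane → ℝ, ContDiff ℝ 1 ζ →
      HasCompactSupport ζ → tsupport ζ ⊆ Metric.ball p r →
        ∫ q in B, fderiv ℝ ζ q (rigidField c₁ c₂ k q) = 0 := by
    intro p
    by_cases hp : p ∈ tsupport θ ∩ closure B
    · obtain ⟨r, hr⟩ := hloc p hp
      exact ⟨r, fun _ => hr⟩
    · exact ⟨0, fun h => absurd h hp⟩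
  choose r hr using this
  obtain ⟨t, ζ, ht, hζ, hsum⟩ := exists_smooth_splitting (B := B) hθ hs
    (fun p => Metric.ball p (r p)) (fun p => Metric.isOpen_ball)
    (fun p hp => Metric.mem_ball_self (hr p hp).1)
  have hfd : ∀ q ∈ B, fderiv ℝ θ q (rigidField c₁ c₂ k q) =
      ∑ i, fderiv ℝ (ζ i) q (rigidField c₁ c₂ k q) := by
    intro q hq
    have heq : θ =ᶠ[𝓝 q] fun x => ∑ i, ζ i x := by
      filter_upwards [hB.mem_nhds hq] with x hx using hsum x hx
    rw [heq.fderiv_eq, fderiv_fun_sum fun i _ => ((hζ i).1.differentiable one_ne_zero) q,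
      _root_.sum_apply]
  rw [setIntegral_congr_fun hB.measurableSet hfd, integral_finsetSum _ fun i _ =>
    (integrable_fderiv_rigidField c₁ c₂ k (hζ i).1 (hζ i).2.1).integrableOn]
  exact Finset.sum_eq_zero fun i _ => (hr i (ht i)).2 _ (hζ i).1 (hζ i).2.1 (hζ i).2.2

end RigidField

namespace FloatingSystem

variable {C : FloatingSystem}

/-! ### The body near the wetted contour -/

lemma mem_closure_immersed {p : Plane} (hp : p ∈ closure C.body) (hp1 : p 1 < 0) :
    p ∈ closure C.immersed := by
  have ho : IsOpen {p : Plane | p 1 < 0} := isOpen_lt (by fun_prop) continuous_const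
  exact ho.closure_inter ⟨hp, hp1⟩

/-- The supremum of `|y|` over `B` bounds `|y|` on the closure as well and is strictly below the
depth, so the body stays clear of the bottom. -/
lemma IsAdmissible.neg_lt_depth (hC : C.IsAdmissible) {p : Plane} (hp : p ∈ closure C.immersed) :
    ((-(p 1) : ℝ) : WithTop ℝ) < C.depth := by
  refine lt_of_le_of_lt (WithTop.coe_le_coe.2 ?_) hC.draught_lt_depth
  have hbdd : BddAbove ((fun p : Plane => |p 1|) '' C.immersed) := by
    obtain ⟨R, hR⟩ := hC.body_bounded.subset_closedBall 0
    refine ⟨R, ?_⟩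
    rintro _ ⟨q, hq, rfl⟩
    have h1 : |q 1| ≤ ‖q‖ := by simpa using PiLp.norm_apply_le q 1
    exact h1.trans (mem_closedBall_zero_iff.1 (hR hq.1))
  have hcl : closure C.immersed ⊆
      {q : Plane | |q 1| ≤ sSup ((fun p : Plane => |p 1|) '' C.immersed)} :=
    closure_minimal (fun q hq => le_csSup hbdd ⟨q, hq, rfl⟩)
      (isClosed_le (by fun_prop) continuous_const)
  exact (neg_le_abs _).trans (hcl hp)

lemma isOpen_above_bottom : IsOpen {q : Plane | ((-(q 1) : ℝ) : WithTop ℝ) < C.depth} := by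
  generalize C.depth = h
  induction h with
  | top => simp only [WithTop.coe_lt_top, isOpen_const]
  | coe h =>
    simp only [WithTop.coe_lt_coe]
    exact isOpen_lt (by fun_prop) continuous_const

lemma mem_wetted_of_notMem_body {q : Plane} (hC : C.IsAdmissible) (hq : q ∈ closure C.body)
    (hq1 : q 1 < 0) (hqb : q ∉ C.body) : q ∈ C.wetted :=
  ⟨by rw [hC.body_open.frontier_eq]; exact ⟨hq, hqb⟩, hq1⟩

lemma IsAdmissible.immersed_notMem_closure_water (hC : C.IsAdmissible) {q : Plane}
    (hq : q ∈ C.immersed) : q ∉ closure C.water := by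
  intro hcl
  obtain ⟨x, hx, hxW⟩ := mem_closure_iff.1 hcl _ hC.immersed_isOpen hq
  exact hxW.2 (subset_closure hx)

/-- Near a point of the wetted contour the body is the domain above a Lipschitz graph. -/
lemma IsAdmissible.exists_local_graph (hC : C.IsAdmissible) {p : Plane} (hp : p ∈ C.wetted) :
    ∃ (e : OrthonormalBasis (Fin 2) ℝ Plane) (f : ℝ → ℝ) (L : NNReal) (r : ℝ),
      IsLocalSubgraph C.water p e f L r ∧
        (∀ q ∈ Metric.ball p r, q ∈ C.immersed ↔ f ⟪e 0, q⟫_ℝ < ⟪e 1, q⟫_ℝ) ∧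
        ∀ q ∈ Metric.ball p r, q ∈ frontier C.water → q ∈ C.wetted := by
  obtain ⟨e, f, L, r₀, h₀⟩ := hC.water_lipschitz.lipschitz.exists_isLocalSubgraph
    (hC.wetted_subset hp)
  have hpB : p ∈ closure C.immersed := mem_closure_immersed (wetted_subset_closure_body hp) hp.2
  have hopen : IsOpen
      ({q : Plane | q 1 < 0} ∩ {q : Plane | ((-(q 1) : ℝ) : WithTop ℝ) < C.depth}) :=
    (isOpen_lt (by fun_prop) continuous_const).inter isOpen_above_bottom
  -- In a ball that meets neither the `x`-axis nor the bottom, the water is exactly the complement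
  -- of the closed immersed part.
  obtain ⟨r₁, hr₁, H⟩ := Metric.isOpen_iff.1 hopen p ⟨hp.2, hC.neg_lt_depth hpB⟩
  have h : IsLocalSubgraph C.water p e f L (min r₀ r₁) :=
    ⟨h₀.lipschitz, lt_min h₀.pos hr₁, fun q hq =>
      h₀.mem_iff q (Metric.ball_subset_ball (min_le_left _ _) hq)⟩
  have hH : ∀ q ∈ Metric.ball p (min r₀ r₁), q 1 < 0 ∧ ((-(q 1) : ℝ) : WithTop ℝ) < C.depth :=
    fun q hq => H (Metric.ball_subset_ball (min_le_right _ _) hq)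
  have hbody : ∀ q ∈ Metric.ball p (min r₀ r₁), q ∉ C.water → q ∈ closure C.body := by
    intro q hq hqW
    by_contra hcl
    exact hqW ⟨hH q hq, fun hB => hcl (closure_mono inter_subset_left hB)⟩
  have himm : ∀ q ∈ Metric.ball p (min r₀ r₁), q ∈ C.immersed → f ⟪e 0, q⟫_ℝ < ⟪e 1, q⟫_ℝ := by
    intro q hq hqB
    have hW := hC.immersed_notMem_closure_water hqB
    refine lt_of_le_of_ne (not_lt.1 fun hlt => ?_) fun heq => ?_
    · exact hW (subset_closure ((h.mem_iff q hq).2 hlt))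
    · exact hW (frontier_subset_closure ((h.mem_frontier_iff hq).2 heq.symm))
  refine ⟨e, f, L, min r₀ r₁, h, fun q hq => ⟨himm q hq, fun hlt => ?_⟩, fun q hq hqW => ?_⟩
  -- A point of the closed body that is not in the body lies on `S`, hence on the graph; strictly
  -- above the graph only points of the body are left.
  · have hqW : q ∉ C.water := fun hqW => lt_asymm hlt ((h.mem_iff q hq).1 hqW)
    refine ⟨?_, (hH q hq).1⟩
    by_contra hqb
    have := mem_wetted_of_notMem_body hC (hbody q hq hqW) (hH q hq).1 hqb
    exact hlt.ne' ((h.mem_frontier_iff hq).1 (hC.wetted_subset this))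
  · have hqn : q ∉ C.water := fun hm => by
      rw [hC.water_lipschitz.isOpen.frontier_eq] at hqW
      exact hqW.2 hm
    refine mem_wetted_of_notMem_body hC (hbody q hq hqn) (hH q hq).1 fun hqb => ?_
    exact (himm q hq ⟨hqb, (hH q hq).1⟩).ne' ((h.mem_frontier_iff hq).1 hqW)

/-- A rigid field that is tangent to the wetted contour has no flux through it. -/
lemma IsAdmissible.integral_fderiv_rigidField (hC : C.IsAdmissible) {c₁ c₂ k : ℝ}
    (ht : ∀ᵐ q ∂arcLength.restrict C.wetted,
      ⟪exteriorNormal C.water q, rigidField c₁ c₂ k q⟫_ℝ = 0)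
    {θ : Plane → ℝ} (hθ : ContDiff ℝ (⊤ : ℕ∞) θ) (hs : HasCompactSupport θ)
    (hθs : tsupport θ ⊆ {p | p 1 < 0}) :
    ∫ q in C.immersed, fderiv ℝ θ q (rigidField c₁ c₂ k q) = 0 := by
  have hBm := hC.immersed_isOpen.measurableSet
  refine integral_fderiv_rigidField_of_local hC.immersed_isOpen hθ hs fun p hp => ?_
  by_cases hpB : p ∈ C.immersed
  · obtain ⟨r, hr, hrB⟩ := Metric.isOpen_iff.1 hC.immersed_isOpen p hpB
    exact ⟨r, hr, fun ζ hζ hζc hζs =>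
      integral_fderiv_rigidField_of_tsupport_subset hBm hζ hζc hζs hrB⟩
  · have hp1 : p 1 < 0 := hθs hp.1
    have hpS : p ∈ C.wetted := mem_wetted_of_notMem_body hC
      (closure_mono inter_subset_left hp.2) hp1 fun hb => hpB ⟨hb, hp1⟩
    obtain ⟨e, f, L, r, h, hB, hS⟩ := hC.exists_local_graph hpS
    refine ⟨r, h.pos, fun ζ hζ hζc hζs =>
      integral_fderiv_rigidField_above_graph h.lipschitz hBm hB ?_ hζ hζc hζs⟩
    filter_upwards [h.eventually_graphMap_mem ht hS,
      h.lipschitz.ae_differentiableAt (μ := volume)] with x hx hd hxb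
    have := hx hxb
    rw [h.exteriorNormal_graphMap hxb hd, graphNormal, inner_smul_left, mul_eq_zero] at this
    refine this.resolve_left ?_
    simp only [conj_trivial]
    positivity

end FloatingSystem

namespace FloatingSystem

variable {C : FloatingSystem}

/-! ### The body near the free surface -/

/-- Near a point of the free surface the water fills the lower half-plane. -/
lemma IsAdmissible.notMem_closure_immersed (hC : C.IsAdmissible) {p : Plane} (hp1 : p 1 = 0)
    (hp0 : C.a < |p 0|) : p ∉ closure C.immersed := by
  have hFS : ∀ q : Plane, q 1 = 0 → C.a < |q 0| → q ∈ frontier C.water := by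
    intro q hq1 hq0
    refine hC.freeSurface_subset ⟨hq1, fun hcl => ?_⟩
    have hsub : closure C.waterPlane ⊆ {q : Plane | |q 0| ≤ C.a} := by
      refine closure_minimal (fun x hx => ?_) (isClosed_le (by fun_prop) continuous_const)
      rw [hC.waterPlane_eq] at hx
      exact abs_le.2 ⟨hx.1.le, hx.2.1.le⟩
    exact absurd (hsub hcl) (not_le.2 hq0)
  obtain ⟨e, f, L, r, h⟩ := hC.water_lipschitz.lipschitz.exists_isLocalSubgraph (hFS p hp1 hp0)
  set c := e 0 0 with hc
  set d := e 1 0 with hd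
  -- Near `p` the `x`-axis lies in the boundary of the water, hence in the graph of `f`, where it is
  -- a segment with the direction `(c, d)`.
  obtain ⟨ρ, hρ, hρH⟩ : ∃ ρ > 0, ∀ s : ℝ, |s| < ρ →
      ⟪e 1, p⟫_ℝ + s * d = f (⟪e 0, p⟫_ℝ + s * c) := by
    refine ⟨min r (|p 0| - C.a), lt_min h.pos (by linarith), fun s hs => ?_⟩
    set q : Plane := p + s • EuclideanSpace.single 0 1 with hq
    have hq0 : q 0 = p 0 + s := by simp [hq]
    have hq1 : q 1 = 0 := by simp [hq, hp1]
    have hqF : q ∈ frontier C.water := by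
      refine hFS q hq1 ?_
      rw [hq0]
      have h1 := abs_sub_abs_le_abs_sub (p 0) (-s)
      rw [abs_neg, sub_neg_eq_add] at h1
      linarith [hs.trans_le (min_le_right _ _)]
    have hqb : q ∈ Metric.ball p r := by
      rw [Metric.mem_ball, dist_eq_norm, hq, add_sub_cancel_left, norm_smul]
      simpa using hs.trans_le (min_le_left _ _)
    have := (h.mem_frontier_iff hqb).1 hqF
    rw [inner_plane, inner_plane, hq0, hq1] at this
    rw [inner_plane, inner_plane, hp1]
    rw [← hc, ← hd] at *
    rw [show d * p 0 + e 1 1 * 0 + s * d = d * (p 0 + s) + e 1 1 * 0 by ring, this]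
    congr 1
    ring
  -- Otherwise the segment would be vertical in the chart; lying in a graph it would give `d = 0`
  -- too, and neither basis vector would have a horizontal component.
  have hc0 : c ≠ 0 := by
    intro h0
    have hd0 : d = 0 := by
      have h1 := hρH 0 (by simpa using hρ)
      have h2 := hρH (ρ / 2) (by rw [abs_of_pos (half_pos hρ)]; linarith)
      simp only [h0, mul_zero, zero_mul, add_zero] at h1 h2
      rw [← h1] at h2
      have : ρ / 2 * d = 0 := by linarith
      exact (mul_eq_zero.1 this).resolve_left (by positivity)
    have hs := norm_frame_sq e (⟪e 0, EuclideanSpace.single 0 (1 : ℝ)⟫_ℝ,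
      ⟪e 1, EuclideanSpace.single 0 (1 : ℝ)⟫_ℝ)
    rw [frame_inner] at hs
    simp [inner_plane, ← hc, ← hd, h0, hd0] at hs
  -- The height of `q` over the segment in the chart is `γ` times the ordinate of `q`; `γ` is
  -- positive because the water lies in `y < 0`.
  set γ := e 1 1 - d / c * e 0 1 with hγ
  have hmem : ∀ q ∈ Metric.ball p (min r (ρ * |c|)), q ∈ C.water ↔ γ * q 1 < 0 := by
    intro q hq
    rw [h.mem_iff q (Metric.ball_subset_ball (min_le_left _ _) hq)]
    set s := (⟪e 0, q⟫_ℝ - ⟪e 0, p⟫_ℝ) / c with hs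
    have hsρ : |s| < ρ := by
      rw [hs, abs_div, div_lt_iff₀ (abs_pos.2 hc0), ← inner_sub_right]
      rw [Metric.mem_ball, dist_eq_norm] at hq
      have := abs_real_inner_le_norm (e 0) (q - p)
      rw [e.norm_eq_one, one_mul] at this
      exact this.trans_lt (hq.trans_le (min_le_right _ _))
    have h1 := hρH s hsρ
    have h2 : ⟪e 0, p⟫_ℝ + s * c = ⟪e 0, q⟫_ℝ := by rw [hs]; field_simp; ring
    rw [h2] at h1
    rw [← h1]
    have h3 : ⟪e 1, q⟫_ℝ - (⟪e 1, p⟫_ℝ + s * d) = γ * q 1 := by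
      rw [hs, hγ]
      simp only [inner_plane, hp1, ← hc, ← hd]
      field_simp
      ring
    rw [← h3, sub_neg]
  have hρ' : 0 < min r (ρ * |c|) := lt_min h.pos (mul_pos hρ (abs_pos.2 hc0))
  have hγ0 : 0 < γ := by
    have hpcl : p ∈ closure C.water := frontier_subset_closure (hFS p hp1 hp0)
    obtain ⟨q, hq, hqW⟩ := mem_closure_iff.1 hpcl _ Metric.isOpen_ball (Metric.mem_ball_self hρ')
    have h1 := (hmem q hq).1 hqW
    have h2 : q 1 < 0 := hqW.1.1
    by_contra hneg
    nlinarith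
  intro hcl
  obtain ⟨q, hq, hqB⟩ := mem_closure_iff.1 hcl _ Metric.isOpen_ball (Metric.mem_ball_self hρ')
  have : q ∈ C.water := (hmem q hq).2 (mul_neg_of_pos_of_neg hγ0 hqB.2)
  exact this.2 (subset_closure hqB)

/-! ### The flux through the water plane -/

/-- A smooth function equal to `1` for `y ≤ -2` and to `0` for `y ≥ -1`. -/
def lowerStep (y : ℝ) : ℝ := Real.smoothTransition (-y - 1)

lemma contDiff_lowerStep {n : ℕ∞} : ContDiff ℝ n lowerStep :=
  Real.smoothTransition.contDiff.comp (by fun_prop)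

lemma lowerStep_eq_one {y : ℝ} (hy : y ≤ -2) : lowerStep y = 1 :=
  Real.smoothTransition.one_of_one_le (by linarith)

lemma lowerStep_eq_zero {y : ℝ} (hy : -1 ≤ y) : lowerStep y = 0 :=
  Real.smoothTransition.zero_of_nonpos (by linarith)

lemma deriv_lowerStep_eq_zero {y : ℝ} (hy : y ∉ Icc (-2 : ℝ) (-1)) : deriv lowerStep y = 0 := by
  rcases not_and_or.1 hy with h | h
  · have : lowerStep =ᶠ[𝓝 y] fun _ => 1 := by
      filter_upwards [Iio_mem_nhds (not_le.1 h)] with z hz using lowerStep_eq_one (le_of_lt hz)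
    rw [this.deriv_eq, deriv_const]
  · have : lowerStep =ᶠ[𝓝 y] fun _ => 0 := by
      filter_upwards [Ioi_mem_nhds (not_le.1 h)] with z hz using lowerStep_eq_zero (le_of_lt hz)
    rw [this.deriv_eq, deriv_const]

lemma continuous_deriv_lowerStep : Continuous (deriv lowerStep) :=
  (contDiff_lowerStep (n := 1)).continuous_deriv le_rfl

lemma hasCompactSupport_deriv_lowerStep : HasCompactSupport (deriv lowerStep) :=
  HasCompactSupport.of_support_subset_isCompact isCompact_Icc fun y hy => by
    by_contra h
    exact hy (deriv_lowerStep_eq_zero h)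

lemma integrable_deriv_lowerStep : Integrable (deriv lowerStep) :=
  continuous_deriv_lowerStep.integrable_of_hasCompactSupport hasCompactSupport_deriv_lowerStep

lemma integral_deriv_lowerStep : ∫ y, deriv lowerStep y = -1 := by
  have h1 : ∫ y, deriv lowerStep y = ∫ y in (-2 : ℝ)..(-1), deriv lowerStep y := by
    rw [intervalIntegral.integral_of_le (by norm_num), ← integral_Icc_eq_integral_Ioc,
      setIntegral_eq_integral_of_forall_compl_eq_zero fun y hy => deriv_lowerStep_eq_zero hy]
  rw [h1, intervalIntegral.integral_deriv_eq_sub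
    (fun y _ => (contDiff_lowerStep (n := 1)).differentiable (by simp) y)
    (continuous_deriv_lowerStep.intervalIntegrable _ _), lowerStep_eq_one le_rfl,
    lowerStep_eq_zero le_rfl]
  norm_num

/-- The average of the indicator of the immersed part over the vertical segment
`-2 ε ≤ y ≤ -ε`, with the weight given by the derivative of the step function. -/
def sliceAverage (C : FloatingSystem) (ε x : ℝ) : ℝ :=
  ∫ y, C.immersed.indicator (fun _ => (1 : ℝ)) (frame stdBasis (x, ε * y)) * deriv lowerStep y

lemma abs_sliceAverage_le (ε x : ℝ) : |C.sliceAverage ε x| ≤ ∫ y, |deriv lowerStep y| := by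
  rw [sliceAverage, ← Real.norm_eq_abs]
  refine norm_integral_le_of_norm_le integrable_deriv_lowerStep.abs (ae_of_all _ fun y => ?_)
  simp only [norm_mul, Real.norm_eq_abs]
  refine mul_le_of_le_one_left (abs_nonneg _) ?_
  by_cases h : frame stdBasis (x, ε * y) ∈ C.immersed <;> simp [h]

lemma IsAdmissible.eventually_sliceAverage (hC : C.IsAdmissible) {x : ℝ} (hx : |x| ≠ C.a) :
    ∀ᶠ ε in 𝓝[>] (0 : ℝ), C.sliceAverage ε x =
      -(Ioo (-C.a) C.a).indicator (fun _ => (1 : ℝ)) x := by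
  have hcont : Continuous fun y : ℝ => frame stdBasis (x, y) :=
    (continuous_frame _).comp (by fun_prop)
  have hp0 : frame stdBasis (x, 0) 0 = x := frame_stdBasis_zero _
  have hp1 : frame stdBasis (x, 0) 1 = 0 := frame_stdBasis_one _
  have hsmall : ∀ {δ ε y : ℝ}, ε ∈ Ioo 0 (δ / 2) → y ∈ Icc (-2 : ℝ) (-1) →
      |ε * y| < δ ∧ ε * y < 0 := by
    intro δ ε y hε hy
    have h1 : ε * y < 0 := mul_neg_of_pos_of_neg hε.1 (by linarith [hy.2])
    refine ⟨?_, h1⟩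
    rw [abs_of_neg h1]
    nlinarith [hε.1, hε.2, hy.1]
  rcases lt_or_gt_of_ne hx with hlt | hgt
  · have hmem : frame stdBasis (x, 0) ∈ C.body := by
      have : frame stdBasis (x, 0) ∈ C.waterPlane := by
        rw [hC.waterPlane_eq]
        have := abs_lt.1 hlt
        exact ⟨by rw [hp0]; exact this.1, by rw [hp0]; exact this.2, hp1⟩
      exact this.1
    have hev := hcont.continuousAt.eventually (hC.body_open.mem_nhds hmem)
    obtain ⟨δ, hδ, H⟩ := Metric.eventually_nhds_iff.1 hev
    filter_upwards [Ioo_mem_nhdsGT (half_pos hδ)] with ε hε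
    rw [indicator_of_mem (s := Ioo (-C.a) C.a) (abs_lt.1 hlt), ← integral_deriv_lowerStep]
    refine integral_congr_ae (ae_of_all _ fun y => ?_)
    by_cases hy : y ∈ Icc (-2 : ℝ) (-1)
    · obtain ⟨h1, h2⟩ := hsmall hε hy
      have hB : frame stdBasis (x, ε * y) ∈ C.immersed :=
        ⟨H (by rw [Real.dist_eq, sub_zero]; exact h1), by
          rw [mem_ofPred_eq, frame_stdBasis_one]; exact h2⟩
      simp [hB]
    · simp [deriv_lowerStep_eq_zero hy]
  · have hmem : frame stdBasis (x, 0) ∈ (closure C.immersed)ᶜ :=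
      hC.notMem_closure_immersed hp1 (by rw [hp0]; exact hgt)
    have hev := hcont.continuousAt.eventually (isClosed_closure.isOpen_compl.mem_nhds hmem)
    obtain ⟨δ, hδ, H⟩ := Metric.eventually_nhds_iff.1 hev
    filter_upwards [Ioo_mem_nhdsGT (half_pos hδ)] with ε hε
    have hxn : x ∉ Ioo (-C.a) C.a := fun h => lt_asymm hgt (abs_lt.2 h)
    rw [indicator_of_notMem hxn, neg_zero]
    refine integral_eq_zero_of_ae (ae_of_all _ fun y => ?_)
    by_cases hy : y ∈ Icc (-2 : ℝ) (-1)
    · obtain ⟨h1, h2⟩ := hsmall hε hy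
      have hB : frame stdBasis (x, ε * y) ∉ C.immersed := fun h =>
        H (by rw [Real.dist_eq, sub_zero]; exact h1) (subset_closure h)
      simp [hB]
    · simp [deriv_lowerStep_eq_zero hy]

lemma IsAdmissible.integral_slices (hC : C.IsAdmissible) {ε : ℝ} (hε : 0 < ε) {F : ℝ → ℝ}
    (hF : Continuous F) :
    ∫ q in C.immersed, ε⁻¹ * deriv lowerStep (ε⁻¹ * q 1) * F (q 0) =
      ∫ x, F x * C.sliceAverage ε x := by
  have hBm := hC.immersed_isOpen.measurableSet
  have hd := continuous_deriv_lowerStep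
  have hint : IntegrableOn (fun q : Plane => ε⁻¹ * deriv lowerStep (ε⁻¹ * q 1) * F (q 0))
      C.immersed :=
    ((by fun_prop : Continuous fun q : Plane =>
      ε⁻¹ * deriv lowerStep (ε⁻¹ * q 1) * F (q 0)).continuousOn.integrableOn_compact
        hC.body_bounded.isCompact_closure).mono_set
        (inter_subset_left.trans subset_closure)
  have hint' : Integrable fun z : ℝ × ℝ => C.immersed.indicator (fun q : Plane =>
      ε⁻¹ * deriv lowerStep (ε⁻¹ * q 1) * F (q 0)) (frame stdBasis z) :=
    (measurePreserving_frame stdBasis).integrable_comp_of_integrable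
      (hint.integrable_indicator hBm)
  rw [← integral_indicator hBm, ← (measurePreserving_frame stdBasis).integral_comp
    (measurableEmbedding_frame stdBasis), Measure.volume_eq_prod, integral_prod _ hint']
  refine integral_congr_ae (ae_of_all _ fun x => ?_)
  simp only
  have h1 := Measure.integral_comp_mul_left (fun y => C.immersed.indicator (fun q : Plane =>
    ε⁻¹ * deriv lowerStep (ε⁻¹ * q 1) * F (q 0)) (frame stdBasis (x, y))) ε
  rw [abs_of_pos (inv_pos.2 hε), smul_eq_mul, eq_inv_mul_iff_mul_eq₀ hε.ne'] at h1
  rw [← h1, sliceAverage, ← integral_const_mul, ← integral_const_mul]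
  refine integral_congr_ae (ae_of_all _ fun y => ?_)
  simp only
  by_cases h : frame stdBasis (x, ε * y) ∈ C.immersed
  · rw [indicator_of_mem h, indicator_of_mem h, frame_stdBasis_one, frame_stdBasis_zero]
    field_simp
  · simp [h]

/-- The derivative of the scaled step concentrates at the `x`-axis and turns an integral over `B`
into minus an integral over `D`; slices are bounded uniformly and vanish outside a fixed interval,
whence dominated convergence. -/
lemma IsAdmissible.tendsto_integral_slices (hC : C.IsAdmissible) {F : ℝ → ℝ} (hF : Continuous F) :
    Tendsto (fun n : ℕ => ∫ q in C.immersed,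
        ((n : ℝ) + 1) * deriv lowerStep (((n : ℝ) + 1) * q 1) * F (q 0)) atTop
      (𝓝 (-∫ x in Ioo (-C.a) C.a, F x)) := by
  obtain ⟨R, hR0, hR⟩ := hC.exists_body_subset
  set M := ∫ y, |deriv lowerStep y| with hM
  have hM0 : 0 ≤ M := integral_nonneg fun y => abs_nonneg _
  set ε : ℕ → ℝ := fun n => ((n : ℝ) + 1)⁻¹ with hε
  have hε0 : ∀ n, 0 < ε n := fun n => by positivity
  have hlim : Tendsto ε atTop (𝓝[>] 0) := by
    refine tendsto_nhdsWithin_iff.2 ⟨?_, Eventually.of_forall hε0⟩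
    simpa [hε, one_div] using tendsto_one_div_add_atTop_nhds_zero_nat (𝕜 := ℝ)
  have heq : ∀ n : ℕ, ∫ q in C.immersed,
      ((n : ℝ) + 1) * deriv lowerStep (((n : ℝ) + 1) * q 1) * F (q 0) =
        ∫ x, F x * C.sliceAverage (ε n) x := fun n => by
    have := hC.integral_slices (hε0 n) hF
    simpa [hε] using this
  simp_rw [heq]
  have htarget : -∫ x in Ioo (-C.a) C.a, F x =
      ∫ x, F x * -(Ioo (-C.a) C.a).indicator (fun _ => (1 : ℝ)) x := by
    rw [← integral_indicator measurableSet_Ioo, ← integral_neg]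
    refine integral_congr_ae (ae_of_all _ fun x => ?_)
    by_cases h : x ∈ Ioo (-C.a) C.a <;> simp [h]
  rw [htarget]
  have hsupp : ∀ n x, x ∉ Icc (-R) R → C.sliceAverage (ε n) x = 0 := by
    intro n x hx
    refine integral_eq_zero_of_ae (ae_of_all _ fun y => ?_)
    have : frame stdBasis (x, ε n * y) ∉ C.immersed := fun h => hx (by
      have h1 := hR (subset_closure h.1)
      rw [mem_closedBall_zero_iff] at h1
      exact abs_le.1 ((abs_fst_le_norm_frame stdBasis (x, ε n * y)).trans h1))
    simp [this]
  refine tendsto_integral_of_dominated_convergence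
    ((Icc (-R) R).indicator fun x => |F x| * M) (fun n => ?_) ?_
    (fun n => ae_of_all _ fun x => ?_) ?_
  · refine hF.aestronglyMeasurable.mul ?_
    have hmeas : StronglyMeasurable (Function.uncurry fun x y : ℝ =>
        C.immersed.indicator (fun _ => (1 : ℝ)) (frame stdBasis (x, ε n * y)) *
          deriv lowerStep y) := by
      have h1 : Measurable (C.immersed.indicator fun _ : Plane => (1 : ℝ)) :=
        measurable_const.indicator hC.immersed_isOpen.measurableSet
      have h2 : Measurable fun z : ℝ × ℝ => frame stdBasis (z.1, ε n * z.2) :=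
        ((continuous_frame stdBasis).comp (by fun_prop)).measurable
      exact ((h1.comp h2).mul
        (continuous_deriv_lowerStep.measurable.comp measurable_snd)).stronglyMeasurable
    exact hmeas.integral_prod_right.aestronglyMeasurable
  · rw [integrable_indicator_iff measurableSet_Icc]
    exact (hF.abs.mul continuous_const).continuousOn.integrableOn_compact isCompact_Icc
  · by_cases hx : x ∈ Icc (-R) R
    · rw [indicator_of_mem hx, norm_mul, Real.norm_eq_abs, Real.norm_eq_abs]
      exact mul_le_mul_of_nonneg_left (abs_sliceAverage_le _ _) (abs_nonneg _)
    · rw [indicator_of_notMem hx, hsupp n x hx, mul_zero, norm_zero]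
  · have hne : ∀ᵐ x : ℝ, |x| ≠ C.a := by
      have h1 : ∀ᵐ x : ℝ, x ≠ C.a := measure_eq_zero_iff_ae_notMem.1 (measure_singleton _)
      have h2 : ∀ᵐ x : ℝ, x ≠ -C.a := measure_eq_zero_iff_ae_notMem.1 (measure_singleton _)
      filter_upwards [h1, h2] with x hx1 hx2 h
      rcases (abs_eq hC.a_pos.le).1 h with h | h
      · exact hx1 h
      · exact hx2 h
    filter_upwards [hne] with x hx
    refine tendsto_const_nhds.congr' ?_
    filter_upwards [hlim.eventually (hC.eventually_sliceAverage hx)] with n hn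
    rw [hn]

end FloatingSystem

/-! ### Rigid motions tangent to the wetted contour -/

namespace FloatingSystem

variable {C : FloatingSystem}

/-- The factor `c₂ + k x` is the vertical component of the field itself, so differentiating the step
along the field yields its square. -/
lemma fderiv_step_mul_affine (m c₁ c₂ k : ℝ) (q : Plane) :
    fderiv ℝ (fun q : Plane => lowerStep (m * q 1) * (c₂ + k * q 0)) q (rigidField c₁ c₂ k q) =
      lowerStep (m * q 1) * (k * (c₁ - k * q 1)) +
        m * deriv lowerStep (m * q 1) * (c₂ + k * q 0) ^ 2 := by
  have h0 : HasFDerivAt (fun q : Plane => q 0) (EuclideanSpace.proj 0 : Plane →L[ℝ] ℝ) q :=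
    (EuclideanSpace.proj 0 : Plane →L[ℝ] ℝ).hasFDerivAt
  have h1 : HasFDerivAt (fun q : Plane => q 1) (EuclideanSpace.proj 1 : Plane →L[ℝ] ℝ) q :=
    (EuclideanSpace.proj 1 : Plane →L[ℝ] ℝ).hasFDerivAt
  have hs : HasDerivAt lowerStep (deriv lowerStep (m * q 1)) (m * q 1) :=
    ((contDiff_lowerStep (n := 1)).differentiable (by simp) _).hasDerivAt
  have h := (hs.comp_hasFDerivAt q (h1.const_mul m)).mul ((h0.const_mul k).const_add c₂)
  have h' : HasFDerivAt (fun q : Plane => lowerStep (m * q 1) * (c₂ + k * q 0)) _ q := h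
  rw [h'.fderiv]
  simp [rigidField]
  ring

/-- Balance of the fluxes of a rigid field, tangent to the wetted contour, multiplied by its
vertical component. -/
lemma IsAdmissible.rigidField_flux (hC : C.IsAdmissible) {c₁ c₂ k : ℝ}
    (ht : ∀ᵐ q ∂arcLength.restrict C.wetted,
      ⟪exteriorNormal C.water q, rigidField c₁ c₂ k q⟫_ℝ = 0) :
    ∫ q in C.immersed, k * (c₁ - k * q 1) = ∫ x in Ioo (-C.a) C.a, (c₂ + k * x) ^ 2 := by
  obtain ⟨R, hR0, hR⟩ := hC.exists_body_subset
  have hBm := hC.immersed_isOpen.measurableSet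
  have hcpt := hC.body_bounded.isCompact_closure
  have hsub : C.immersed ⊆ closure C.body := inter_subset_left.trans subset_closure
  have hstep := (contDiff_lowerStep (n := 1)).continuous
  have hd := continuous_deriv_lowerStep
  have hion : ∀ {F : Plane → ℝ}, Continuous F → IntegrableOn F C.immersed := fun hF =>
    (hF.continuousOn.integrableOn_compact hcpt).mono_set hsub
  have hzero : ∀ n : ℕ, (∫ q in C.immersed,
      lowerStep (((n : ℝ) + 1) * q 1) * (k * (c₁ - k * q 1))) +
      ∫ q in C.immersed, ((n : ℝ) + 1) * deriv lowerStep (((n : ℝ) + 1) * q 1) *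
        (c₂ + k * q 0) ^ 2 = 0 := by
    intro n
    set m : ℝ := (n : ℝ) + 1 with hm
    have hm0 : 0 < m := by positivity
    -- The step keeps the support below the `x`-axis, where the boundary of the body is a local
    -- Lipschitz graph; the cutoff equals `1` on the body and only makes the support compact.
    set θ : Plane → ℝ := fun q => cutoff R q * (lowerStep (m * q 1) * (c₂ + k * q 0)) with hθ
    have hθc : ContDiff ℝ (⊤ : ℕ∞) θ :=
      (contDiff_cutoff R).mul ((contDiff_lowerStep.comp (by fun_prop)).mul (by fun_prop))
    have hcs : HasCompactSupport θ := HasCompactSupport.mul_right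
      (HasCompactSupport.of_support_subset_isCompact (isCompact_closedBall 0 (2 * R))
        ((subset_tsupport _).trans (tsupport_cutoff_subset hR0)))
    have hts : tsupport θ ⊆ {q : Plane | q 1 < 0} := by
      have hcl : tsupport θ ⊆ {q : Plane | m * q 1 ≤ -1} := by
        refine closure_minimal (fun q hq => ?_) (isClosed_le (by fun_prop) continuous_const)
        by_contra h
        exact hq (by simp [hθ, lowerStep_eq_zero (not_le.1 h).le])
      intro q hq
      have h1 : m * q 1 ≤ -1 := hcl hq
      change q 1 < 0
      by_contra h
      nlinarith [mul_nonneg hm0.le (not_lt.1 h)]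
    have hfd : ∀ q ∈ C.immersed, fderiv ℝ θ q (rigidField c₁ c₂ k q) =
        lowerStep (m * q 1) * (k * (c₁ - k * q 1)) +
          m * deriv lowerStep (m * q 1) * (c₂ + k * q 0) ^ 2 := by
      intro q hq
      rw [← fderiv_step_mul_affine]
      congr 1
      refine Filter.EventuallyEq.fderiv_eq ?_
      filter_upwards [hC.immersed_isOpen.mem_nhds hq] with x hx
      simp only [hθ]
      rw [cutoff_eq_one hR0 (mem_closedBall_zero_iff.1 (hR (hsub hx))), one_mul]
    have := hC.integral_fderiv_rigidField ht hθc hcs hts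
    rwa [setIntegral_congr_fun hBm hfd, integral_add (hion (by fun_prop)) (hion (by fun_prop))]
      at this
  have hL1 : Tendsto (fun n : ℕ => ∫ q in C.immersed,
      lowerStep (((n : ℝ) + 1) * q 1) * (k * (c₁ - k * q 1))) atTop
      (𝓝 (∫ q in C.immersed, k * (c₁ - k * q 1))) := by
    refine tendsto_integral_of_dominated_convergence (fun q => |k * (c₁ - k * q 1)|)
      (fun n => (by fun_prop : Continuous fun q : Plane =>
        lowerStep (((n : ℝ) + 1) * q 1) * (k * (c₁ - k * q 1))).aestronglyMeasurable)
      (hion (by fun_prop)) (fun n => ae_of_all _ fun q => ?_) ?_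
    · rw [norm_mul, Real.norm_eq_abs, Real.norm_eq_abs]
      refine mul_le_of_le_one_left (abs_nonneg _) ?_
      rw [lowerStep, abs_of_nonneg (Real.smoothTransition.nonneg _)]
      exact Real.smoothTransition.le_one _
    · filter_upwards [ae_restrict_mem hBm] with q hq
      have hq1 : q 1 < 0 := hq.2
      refine tendsto_const_nhds.congr' ?_
      filter_upwards [eventually_ge_atTop ⌈-2 / q 1⌉₊] with n hn
      have h1 : -2 / q 1 ≤ n := Nat.ceil_le.1 hn
      rw [div_le_iff_of_neg hq1] at h1
      rw [lowerStep_eq_one (by nlinarith), one_mul]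
  have hL2 := hC.tendsto_integral_slices (F := fun x => (c₂ + k * x) ^ 2) (by fun_prop)
  have hL := hL1.add hL2
  simp_rw [hzero] at hL
  have := tendsto_nhds_unique hL tendsto_const_nhds
  linarith

/-- A rigid motion without surge that leaves the wetted contour impermeable is trivial. -/
lemma IsEquilibrium.eq_zero_of_tangent (hC : C.IsAdmissible) (hE : C.IsEquilibrium)
    {χ : Fin 3 → ℝ} (h0 : χ 0 = 0)
    (ht : ∀ᵐ q ∂arcLength.restrict C.wetted, C.normalN q ⬝ᵥ χ = 0) : χ = 0 := by
  -- For `χ 0 = 0` this is the velocity field of the motion `χ` about the centre of mass; its normal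
  -- component is `Nᵀχ`.
  have hflux := hC.rigidField_flux (c₁ := χ 2 * C.y₀) (c₂ := χ 1 - χ 2 * C.x₀) (k := χ 2) (by
    filter_upwards [ht] with q hq
    rw [inner_plane, ← hq]
    simp only [rigidField, normalN, dotProduct, Fin.sum_univ_three, h0, cons_val_zero,
      cons_val_one, cons_val, PiLp.toLp_apply]
    ring)
  have h1 : ∫ q in C.immersed, χ 2 * (χ 2 * C.y₀ - χ 2 * q 1) = -(χ 2 ^ 2) * C.momentBy := by
    rw [momentBy, ← integral_const_mul]
    exact integral_congr_ae (ae_of_all _ fun q => by ring)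
  have hi : ∀ {F : ℝ → ℝ}, Continuous F → IntegrableOn F (Ioo (-C.a) C.a) := fun hF =>
    (hF.continuousOn.integrableOn_compact isCompact_Icc).mono_set Ioo_subset_Icc_self
  have h2 : ∫ x in Ioo (-C.a) C.a, (χ 1 - χ 2 * C.x₀ + χ 2 * x) ^ 2 =
      χ 1 ^ 2 * C.momentD + (2 * χ 1 * χ 2) * C.momentDx + χ 2 ^ 2 * C.momentDxx := by
    rw [momentD, momentDx, momentDxx, ← integral_const_mul, ← integral_const_mul,
      ← integral_const_mul, ← integral_add (hi (by fun_prop)) (hi (by fun_prop)),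
      ← integral_add (hi (by fun_prop)) (hi (by fun_prop))]
    exact integral_congr_ae (ae_of_all _ fun x => by ring)
  rw [h1, h2] at hflux
  by_contra hne
  have hne' : ![χ 1, χ 2] ≠ 0 := by
    intro h
    apply hne
    have e1 : χ 1 = 0 := congrFun h 0
    have e2 : χ 2 = 0 := congrFun h 1
    ext j
    fin_cases j
    · exact h0
    · exact e1
    · exact e2
  -- The balance of fluxes reads `-χ₂² I^B_y = ∫_D (χ₁ + χ₂ (x - x₀))² dx`: the form that would be
  -- positive here is zero.
  have hpos := hE.matK'_posDef.dotProduct_mulVec_pos hne'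
  simp only [matK', dotProduct, mulVec, Fin.sum_univ_two, star_trivial, of_apply, cons_val',
    cons_val_zero, cons_val_one] at hpos
  nlinarith

/-! ### Non-existence of trapped modes -/

variable {φ : Plane → ℝ} {G : Plane → Plane} {t : Plane → ℝ} {ω : ℝ} {χ : Fin 3 → ℝ}

/-- The gradient is a separate datum, so its vanishing is drawn from the defining identity of the
weak gradient by the fundamental lemma of the calculus of variations. -/
lemma MemEnergySpace.grad_ae_eq_zero (hC : C.IsAdmissible) (h : C.MemEnergySpace φ G t)
    (hφ : φ =ᵐ[volume.restrict C.water] 0) : ∀ᵐ p ∂volume.restrict C.water, G p = 0 := by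
  have hli : LocallyIntegrable G (volume.restrict C.water) :=
    h.grad_memLp.locallyIntegrable one_le_two
  have := hC.water_lipschitz.isOpen.ae_eq_zero_of_integral_contDiff_smul_eq_zero
    (hli.locallyIntegrableOn _) fun ψ hψ hψc hψs => by
      have hw := h.loc.weak ψ hψ hψc hψs
      rw [← neg_eq_zero, ← hw]
      refine integral_eq_zero_of_ae ?_
      filter_upwards [hφ] with p hp
      simp [hp]
  filter_upwards [this, ae_restrict_mem hC.measurableSet_water] with p hp hpW using hp hpW

/-- Test functions supported in `y < 0` vanish on `F`, so nothing need be known about the trace `t`;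
they still suffice to determine a function on `S`. -/
lemma SolvesIntegralIdentity.normal_velocity_ae_eq_zero (hC : C.IsAdmissible) (hω : 0 < ω)
    (hsol : C.SolvesIntegralIdentity ω G t χ)
    (hG : ∀ᵐ p ∂volume.restrict C.water, G p = 0) :
    ∀ᵐ q ∂arcLength.restrict C.wetted, C.normalN q ⬝ᵥ χ = 0 := by
  have : IsFiniteMeasure (arcLength.restrict C.wetted) :=
    ⟨by rw [Measure.restrict_apply_univ]; exact hC.arcLength_wetted_lt_top⟩
  have hint : Integrable (fun q => C.normalN q ⬝ᵥ χ) (arcLength.restrict C.wetted) :=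
    (hC.memLp_normalN_dotProduct χ).integrable one_le_two
  have ho : IsOpen {p : Plane | p 1 < 0} := isOpen_lt (by fun_prop) continuous_const
  have := ho.ae_eq_zero_of_integral_contDiff_smul_eq_zero
    (hint.locallyIntegrable.locallyIntegrableOn _) fun ψ hψ hψc hψs => by
      have hk := hsol ψ hψ hψc
      have e1 : ∫ p in C.water, ⟪G p, gradient ψ p⟫_ℝ = 0 := by
        refine integral_eq_zero_of_ae ?_
        filter_upwards [hG] with p hp
        simp [hp]
      have e2 : ∫ p in C.freeSurface, t p * ψ p ∂arcLength = 0 := by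
        refine integral_eq_zero_of_ae ?_
        filter_upwards [ae_restrict_mem measurableSet_freeSurface] with p hp
        have : ψ p = 0 := image_eq_zero_of_notMem_tsupport fun hmem => by
          have h1 : p 1 < 0 := hψs hmem
          have h2 : p 1 = 0 := hp.1
          exact h1.ne h2
        simp [this]
      rw [e1, e2, mul_zero, zero_add] at hk
      exact (mul_eq_zero.1 hk.symm).resolve_left hω.ne'
  filter_upwards [this, ae_restrict_mem measurableSet_wetted] with q hq hqS using hq hqS.2

/-- The work done by the fluid on the body. -/
lemma MemEnergySpace.work_eq (hC : C.IsAdmissible) (h : C.MemEnergySpace φ G t)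
    (hbody : C.SolvesBodyMotion ω t χ) :
    ω * ∫ p in C.wetted, (C.normalN p ⬝ᵥ χ) * t p ∂arcLength =
      C.gravity * (χ ⬝ᵥ (C.matK *ᵥ χ)) - ω ^ 2 * (χ ⬝ᵥ (C.matE *ᵥ χ)) := by
  have ht := h.memLp_trace_wetted hC
  have hi : ∀ j, Integrable (fun p => t p * C.normalN p j) (arcLength.restrict C.wetted) :=
    fun j => ht.integrable_mul (hC.memLp_normalN j)
  have h1 : ∫ p in C.wetted, (C.normalN p ⬝ᵥ χ) * t p ∂arcLength =
      χ ⬝ᵥ fun j => ∫ p in C.wetted, t p * C.normalN p j ∂arcLength := by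
    simp only [dotProduct]
    simp_rw [← integral_const_mul]
    rw [← integral_finsetSum _ fun j _ => (hi j).const_mul (χ j)]
    refine integral_congr_ae (ae_of_all _ fun p => ?_)
    simp only [Finset.sum_mul]
    exact Finset.sum_congr rfl fun j _ => by ring
  have h2 := congrArg (fun v => χ ⬝ᵥ v) hbody
  simp only [dotProduct_smul, dotProduct_add, dotProduct_neg, smul_eq_mul] at h2
  rw [h1]
  have h3 : (χ ⬝ᵥ ω • fun j => ∫ p in C.wetted, t p * C.normalN p j ∂arcLength) =
      ω * (χ ⬝ᵥ fun j => ∫ p in C.wetted, t p * C.normalN p j ∂arcLength) := by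
    rw [dotProduct_smul, smul_eq_mul]
  linarith

lemma SolvesIntegralIdentity.solvesWaterEquations
    (hsol : C.SolvesIntegralIdentity ω G t χ) : C.SolvesWaterEquations ω G t := by
  intro ψ hψ hψc hdis
  have hz : ∫ p in C.wetted, ψ p * (C.normalN p ⬝ᵥ χ) ∂arcLength = 0 := by
    refine setIntegral_eq_zero_of_forall_eq_zero fun p hp => ?_
    have : ψ p = 0 := image_eq_zero_of_notMem_tsupport fun hmem =>
      disjoint_left.1 hdis hmem (subset_closure hp)
    rw [this, zero_mul]
  rw [hsol ψ hψ hψc, hz, mul_zero, add_zero]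

/-- The argument uses of the function space only that it is contained in the energy space, which
covers both choices at once. -/
theorem not_isTrappingFrequency (hC : C.IsAdmissible) (hE : C.IsEquilibrium) (hω : 0 < ω)
    {lam : ℝ} (hlam : IsGreatest {l : ℝ | (l • C.matE - C.gravity • C.matK).det = 0} lam)
    (hωlam : lam ≤ ω ^ 2) {X : (Plane → ℝ) → (Plane → Plane) → (Plane → ℝ) → Prop}
    (hX : ∀ {φ G t}, X φ G t → C.MemEnergySpace φ G t) (hS : C.StrictEnergyInequality X ω) :
    ¬ C.IsTrappingFrequency X ω := by
  rintro ⟨φ, G, t, χ, hφX, hne, hsol, hbody⟩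
  have h := hX hφX
  have hid := h.energy_identity hC hsol
  have hwork := h.work_eq hC hbody
  have hform := surge_form_le_energy_form hC hE hlam hωlam χ
  have hm := mul_pos (pow_pos hω 2) (hC.massIM_pos hE)
  have hsurge : 0 ≤ ω ^ 2 * C.massIM * χ 0 ^ 2 := mul_nonneg hm.le (sq_nonneg _)
  by_cases hφ : φ =ᵐ[volume.restrict C.water] 0
  · have hG := h.grad_ae_eq_zero hC hφ
    have hN := hsol.normal_velocity_ae_eq_zero hC hω hG
    -- The work vanishes because the normal velocity does; the trace is not shown to be zero.
    have hN0 : ∫ p in C.wetted, (C.normalN p ⬝ᵥ χ) * t p ∂arcLength = 0 := by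
      refine integral_eq_zero_of_ae ?_
      filter_upwards [hN] with p hp
      simp [hp]
    rw [hN0, mul_zero] at hwork
    have h0 : χ 0 = 0 := by
      have : ω ^ 2 * C.massIM * χ 0 ^ 2 = 0 := le_antisymm (by linarith) hsurge
      exact pow_eq_zero_iff two_ne_zero |>.1 ((mul_eq_zero.1 this).resolve_left hm.ne')
    exact hne ⟨hφ, hE.eq_zero_of_tangent hC h0 hN⟩
  -- The energy identity, the work and the bound on the form give the opposite inequality `∫_W |∇φ|²
  -- ≤ ν ∫_F φ²`.
  · have := hS φ G t hφX hφ hsol.solvesWaterEquations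
    linarith

end FloatingSystem

end FreelyFloating

end

theorem proposition2 (C : FreelyFloating.FloatingSystem) (hC : C.IsAdmissible)
    (hE : C.IsEquilibrium) (ω : ℝ) (hω : 0 < ω) (lam : ℝ)
    (hlam : IsGreatest {l : ℝ | (l • C.matE - C.gravity • C.matK).det = 0} lam)
    (hωlam : lam ≤ ω ^ 2) :
    (C.StrictEnergyInequality C.MemH1 ω → ¬ C.IsTrappingFrequency C.MemH1 ω) ∧
      (C.StrictEnergyInequality C.MemEnergySpace ω →
        ¬ C.IsTrappingFrequency C.MemEnergySpace ω) :=
  ⟨C.not_isTrappingFrequency hC hE hω hlam hωlam fun h => h.toMemEnergySpace,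
    C.not_isTrappingFrequency hC hE hω hlam hωlam fun h => h⟩
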